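/- Let $\mathcal X$ be a finite field of prime cardinality $q$, let $W:\mathcal X\to\mathcal Y$ be a discrete memoryless channel (a conditional probability distribution $W(y\mid x)$) with at most countable output alphabet $\mathcal Y$, and let $$I(W)=\sum_{x\in\mathcal X}\sum_{y\in\mathcal Y}\frac1q W(y\mid x)\log_q\frac{W(y\mid x)}{\frac1q\sum_{x'\in\mathcal X}W(y\mid x')}$$ be its symmetric capacity. Let $G$ be an invertible $\ell\times\ell$ matrix over $\mathcal X$, with the associated linear kernel $g(u)=uG$ on row vectors $u=(u_0,\dots,u_{\ell-1})$. For $0\le i<\ell$ let $W^{(i)}:\mathcal X\to\mathcal Y^\ell\times\mathcal X^{i}$ be the channel $$W^{(i)}\big((y_0,\dots,y_{\ell-1}),(u_0,\dots,u_{i-1})\,\big|\,u_i\big)=\frac1{q^{\ell-1}}\sum_{u_{i+1},\dots,u_{\ell-1}\in\mathcal X}\ \prod_{j=0}^{\ell-1}W\big(y_j\mid (uG)_j\big).$$ Let $B_1,B_2,\dots$ be independent random variables, each uniformly distributed on $\{0,\dots,\ell-1\}$, and let $W^{(B_1)\cdots(B_n)}=(\cdots(W^{(B_1)})^{(B_2)}\cdots)^{(B_n)}$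 be the random channel obtained by applying the transforms successively. Every invertible $G$ can be written as $G=VLP$ with $V$ invertible upper triangular, $L$ lower triangular and $P$ a permutation matrix. Call $G$ trivial if it has such a decomposition in which $L$ is diagonal. (A lower triangular invertible $G$ is trivial if and only if it is diagonal.) **Theorem.** If $G$ is not trivial (in particular, if $G$ is lower triangular and not diagonal), then there is a random variable $I_\infty$ such that $I(W^{(B_1)\cdots(B_n)})\to I_\infty$ almost surely as $n\to\infty$, and $\mathbb P(I_\infty\in\{0,1\})=1$. -/

import Mathlib

open Filter Topology MeasureTheory ProbabilityTheory

universe u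

/-- A discrete memoryless channel with input alphabet `X`: an at most countable output alphabet
`Out` and a conditional probability distribution, `prob x y` being `W(y ∣ x)`. -/
structure DMC (X : Type u) where
  Out : Type u
  countable_out : Countable Out
  prob : X → Out → ℝ
  prob_nonneg : ∀ x y, 0 ≤ prob x y
  hasSum_prob : ∀ x, HasSum (prob x) 1

namespace DMC

variable {X : Type u}

/-- The symmetric capacity `I(W)`; the base of the logarithm is `q = |X|`. -/
noncomputable def symCapacity [Fintype X] (W : DMC X) : ℝ :=
  ∑ x, ∑' y, 1 / (Fintype.card X : ℝ) * W.prob x y *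
    Real.logb (Fintype.card X)
      (W.prob x y / (1 / (Fintype.card X : ℝ) * ∑ x', W.prob x' y))

/-- The transition probabilities `W^ℓ(y ∣ x) = ∏ j, W(y j ∣ x j)` of `ℓ` independent uses. -/
noncomputable def powProb {ℓ : ℕ} (W : DMC X) (x : Fin ℓ → X) (y : Fin ℓ → W.Out) : ℝ :=
  ∏ j, W.prob (x j) (y j)

/-- The transition probabilities
`W^{(i)}(y, u_0^{i-1} ∣ u_i) = q^{-(ℓ-1)} ∑_{u_{i+1}^{ℓ-1}} W^ℓ(y ∣ g(u))`.
The sum is over all `u` with prescribed entries in the positions up to `i`: `a` in the position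
`i`, and `z.2` in the positions before `i`. -/
noncomputable def subchannelProb [Fintype X] [DecidableEq X] {ℓ : ℕ} (g : (Fin ℓ → X) → (Fin ℓ → X))
    (W : DMC X) (i : Fin ℓ) (a : X) (z : (Fin ℓ → W.Out) × ({j : Fin ℓ // j < i} → X)) : ℝ :=
  1 / (Fintype.card X : ℝ) ^ (ℓ - 1) *
    ∑ u : Fin ℓ → X with u i = a ∧ ∀ j : {j : Fin ℓ // j < i}, u j = z.2 j, W.powProb (g u) z.1

theorem powProb_nonneg (W : DMC X) {ℓ : ℕ} (x : Fin ℓ → X) (y : Fin ℓ → W.Out) :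
    0 ≤ W.powProb x y :=
  Finset.prod_nonneg fun _ _ => W.prob_nonneg _ _

theorem hasSum_powProb (W : DMC X) {ℓ : ℕ} (x : Fin ℓ → X) : HasSum (W.powProb x) 1 := by
  induction ℓ with
  | zero =>
    have h : W.powProb x = fun _ => 1 := by funext y; simp [powProb]
    rw [h]
    convert hasSum_fintype (fun _ : Fin 0 → W.Out => (1 : ℝ)) using 1
    simp
  | succ n ih =>
    have h := (W.hasSum_prob (x 0)).mul (ih (fun j => x j.succ))
      ((W.hasSum_prob (x 0)).summable.mul_of_nonneg (ih (fun j => x j.succ)).summable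
        (W.prob_nonneg _) (W.powProb_nonneg _))
    rw [mul_one] at h
    rw [← (Fin.consEquiv fun _ => W.Out).hasSum_iff]
    have e : W.powProb x ∘ (Fin.consEquiv fun _ => W.Out) =
        fun p => W.prob (x 0) p.1 * W.powProb (fun j => x j.succ) p.2 := by
      funext p
      simp [powProb, Fin.prod_univ_succ]
    rw [e]
    exact h

theorem card_filter_apply_eq [Fintype X] [DecidableEq X] {ℓ : ℕ} (i : Fin ℓ) (a : X) :
    (Finset.univ.filter fun u : Fin ℓ → X => u i = a).card = Fintype.card X ^ (ℓ - 1) := by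
  have h := Fintype.card_filter_piFinset_const (Finset.univ : Finset X) i a
  simpa using h

theorem hasSum_ite_snd {α β : Type*} {f : α → ℝ} {s : ℝ} (hf : HasSum f s) (b : β)
    (p : β → Prop) [DecidablePred p] (hp : ∀ c, p c ↔ c = b) :
    HasSum (fun z : α × β => if p z.2 then f z.1 else 0) s := by
  have hinj : Function.Injective fun a : α => (a, b) := fun _ _ h => (Prod.mk.inj h).1
  refine (hinj.hasSum_iff ?_).mp ?_
  · rintro ⟨x, c⟩ hx
    refine if_neg fun hc => hx ⟨x, ?_⟩
    rw [(hp c).mp hc]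
  · have e : ((fun z : α × β => if p z.2 then f z.1 else 0) ∘ fun a : α => (a, b)) = f := by
      funext x
      exact if_pos ((hp b).mpr rfl)
    rw [e]
    exact hf

theorem hasSum_subchannelProb [Fintype X] [DecidableEq X] {ℓ : ℕ} (g : (Fin ℓ → X) → (Fin ℓ → X))
    (W : DMC X) (i : Fin ℓ) (a : X) : HasSum (W.subchannelProb g i a) 1 := by
  have key : ∀ u : Fin ℓ → X, HasSum (fun z : (Fin ℓ → W.Out) × ({j : Fin ℓ // j < i} → X) =>
      if u i = a ∧ ∀ j : {j : Fin ℓ // j < i}, u j = z.2 j then W.powProb (g u) z.1 else 0)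
      (if u i = a then 1 else 0) := by
    intro u
    by_cases hu : u i = a
    · rw [if_pos hu]
      exact hasSum_ite_snd (W.hasSum_powProb (g u)) (fun j : {j : Fin ℓ // j < i} => u j)
        (fun p : {j : Fin ℓ // j < i} → X => u i = a ∧ ∀ j : {j : Fin ℓ // j < i}, u j = p j)
        fun p => ⟨fun hh => funext fun j => (hh.2 j).symm, fun hh => ⟨hu, fun j => by rw [hh]⟩⟩
    · simp only [hu, false_and, if_false]
      exact hasSum_zero
  have h := (hasSum_sum fun u (_ : u ∈ Finset.univ) => key u).mul_left
    (1 / (Fintype.card X : ℝ) ^ (ℓ - 1))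
  have hq : (Fintype.card X : ℝ) ≠ 0 := by
    have : Nonempty X := ⟨a⟩
    exact_mod_cast Fintype.card_ne_zero
  have e : (1 / (Fintype.card X : ℝ) ^ (ℓ - 1)) *
      ∑ u : Fin ℓ → X, (if u i = a then (1 : ℝ) else 0) = 1 := by
    rw [Finset.sum_boole, card_filter_apply_eq]
    push_cast
    field_simp
  rw [e] at h
  have e' : W.subchannelProb g i a = fun z => 1 / (Fintype.card X : ℝ) ^ (ℓ - 1) *
      ∑ u : Fin ℓ → X,
        if u i = a ∧ ∀ j : {j : Fin ℓ // j < i}, u j = z.2 j then W.powProb (g u) z.1 else 0 := by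
    funext z
    simp only [subchannelProb, Finset.sum_filter]
  rw [e']
  exact h

/-- The channel `W^{(i)} : X → Out^ℓ × X^i` obtained from `W` with the kernel `g`. -/
noncomputable def subchannel [Fintype X] [DecidableEq X] {ℓ : ℕ} (g : (Fin ℓ → X) → (Fin ℓ → X))
    (W : DMC X) (i : Fin ℓ) : DMC X where
  Out := (Fin ℓ → W.Out) × ({j : Fin ℓ // j < i} → X)
  countable_out := by
    have := W.countable_out
    infer_instance
  prob := W.subchannelProb g i
  prob_nonneg a z := mul_nonneg (by positivity)
    (Finset.sum_nonneg fun _ _ => W.powProb_nonneg _ _)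
  hasSum_prob := W.hasSum_subchannelProb g i

/-- The channel `W^{(b 0)(b 1)⋯(b (n-1))}`, the transform with index `b 0` being applied first. -/
noncomputable def iterSubchannel [Fintype X] [DecidableEq X] {ℓ : ℕ} (g : (Fin ℓ → X) → (Fin ℓ → X))
    (W : DMC X) (b : ℕ → Fin ℓ) : ℕ → DMC X
  | 0 => W
  | n + 1 => (iterSubchannel g W b n).subchannel g (b n)

end DMC

/-- The linear kernel `u ↦ u G`. -/
def linearKernel {X : Type u} [CommRing X] {ℓ : ℕ} (G : Matrix (Fin ℓ) (Fin ℓ) X) :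
    (Fin ℓ → X) → (Fin ℓ → X) :=
  fun u => Matrix.vecMul u G

/-- `G` reduces to a diagonal matrix: `G = V D P` with `V` invertible and upper triangular,
`D` diagonal and `P` a permutation matrix. -/
def IsTrivialKernel {X : Type u} [CommRing X] {ℓ : ℕ} (G : Matrix (Fin ℓ) (Fin ℓ) X) : Prop :=
  ∃ (V D : Matrix (Fin ℓ) (Fin ℓ) X) (π : Equiv.Perm (Fin ℓ)),
    IsUnit V.det ∧ (∀ i j, j < i → V i j = 0) ∧ D.IsDiag ∧ G = V * D * π.permMatrix X

/-- A lower triangular invertible matrix reduces to a diagonal matrix only if it is diagonal. -/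
theorem IsTrivialKernel.isDiag {X : Type u} [Field X] {ℓ : ℕ} {G : Matrix (Fin ℓ) (Fin ℓ) X}
    (h : IsTrivialKernel G) (hG : IsUnit G.det) (hl : ∀ i j, i < j → G i j = 0) : G.IsDiag := by
  obtain ⟨V, D, π, -, hV, hD, hGV⟩ := h
  have hU : ∀ i j, j < i → (V * D) i j = 0 := by
    intro i j hij
    rw [Matrix.mul_apply]
    refine Finset.sum_eq_zero fun k _ => ?_
    by_cases hk : k = j
    · rw [hk, hV i j hij, zero_mul]
    · rw [hD hk, mul_zero]
  have hGU : ∀ i j, G i j = (V * D) i (π.symm j) := by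
    intro i j
    rw [hGV]
    simp [Equiv.Perm.permMatrix, PEquiv.mul_toMatrix_toPEquiv]
  have hdiag : ∀ i, G i i ≠ 0 := by
    rw [Matrix.det_of_isLowerTriangular (M := G) (fun i j hij => hl i j hij), isUnit_iff_ne_zero,
      Finset.prod_ne_zero_iff] at hG
    exact fun i => hG i (Finset.mem_univ i)
  have hle : ∀ i, i ≤ π.symm i := by
    intro i
    by_contra hi
    exact hdiag i ((hGU i i).trans (hU i _ (not_le.mp hi)))
  have hid : ∀ i, π.symm i = i := by
    have hsum : ∑ i : Fin ℓ, (i : ℕ) = ∑ i, ((π.symm i : Fin ℓ) : ℕ) :=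
      (Equiv.sum_comp π.symm fun i : Fin ℓ => (i : ℕ)).symm
    have := (Finset.sum_eq_sum_iff_of_le fun i _ => Fin.le_def.mp (hle i)).mp hsum
    exact fun i => Fin.ext (this i (Finset.mem_univ i)).symm
  intro i j hij
  rcases lt_or_gt_of_ne hij with h | h
  · exact hl i j h
  · rw [hGU, hid]
    exact hU i j h

/-! Put `E(W) = q H(X | Y)` for a uniform input, so that `I(W) = 1 - E(W) / (q log q)`. An
invertible kernel preserves joint entropy, so by the chain rule the `ℓ` subchannels have
equivocations summing to `ℓ E(W)`. Hence `I` along the random path is a martingale with values in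
`[0, 1]`, and it converges almost surely.

To locate the limit, one index `i` must give a quantitative gain. If `G` is not trivial, some row
`i` has two nonzero entries, in columns `j₁`, `j₂` that vanish below it
(`exists_row_of_not_isTrivialKernel`). Given the inputs before `i`, the outputs at `j₁` and `j₂`
alone observe `x` and `b x + s`, where `x` is an affine bijective image of `u_i`, `b ≠ 0`, and `s`
is a linear functional of the past. That functional is nonzero because columns of an invertible
matrix are not proportional, so `s` is uniform (`equivocation_subchannel_le`).

Gibbs' inequality with a Hellinger remainder (`homEntropy.mul_le`) measures the benefit of the
second observation. Averaging over `s` compares a channel with its translates. As `q` is prime,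
every nonzero translation generates the additive group, so the gain dominates a product of two
factors (`homEntropy.sum_shift_le`): one is large unless the input is nearly determined, the other
unless the output is nearly uninformative. This gives `I(W^{(i)}) - I(W) ≥ c I(W) (1 - I(W))²` with
`c > 0` independent of `W` (`DMC.exists_symCapacity_gain`).

Almost surely the index `i` occurs infinitely often, while the increments tend to zero; the limit
`a` therefore satisfies `a (1 - a)² = 0`. -/

/-! ### Entropy inequalities for finite nonnegative vectors -/

/-- The entropy (in nats) of a finite nonnegative vector, extended homogeneously of degree one:
`∑ a, p a * log ((∑ p) / p a)`. -/
noncomputable def homEntropy {A : Type*} [Fintype A] (p : A → ℝ) : ℝ :=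
  ∑ a, p a * (Real.log (∑ b, p b) - Real.log (p a))

namespace homEntropy

variable {A B : Type*} [Fintype A] [Fintype B]

theorem term_nonneg {p : A → ℝ} (hp : ∀ a, 0 ≤ p a) (a : A) :
    0 ≤ p a * (Real.log (∑ b, p b) - Real.log (p a)) := by
  rcases (hp a).eq_or_lt with h | h
  · simp [← h]
  · refine mul_nonneg (hp a) (sub_nonneg.2 (Real.log_le_log h ?_))
    exact Finset.single_le_sum (f := p) (fun b _ => hp b) (Finset.mem_univ a)

theorem nonneg {p : A → ℝ} (hp : ∀ a, 0 ≤ p a) : 0 ≤ homEntropy p :=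
  Finset.sum_nonneg fun a _ => term_nonneg hp a

theorem comp_equiv (e : B ≃ A) (p : A → ℝ) : homEntropy (fun b => p (e b)) = homEntropy p := by
  unfold homEntropy
  rw [e.sum_comp p, e.sum_comp fun a => p a * (Real.log (∑ b, p b) - Real.log (p a))]

theorem const_mul (c : ℝ) (p : A → ℝ) : homEntropy (fun a => c * p a) = c * homEntropy p := by
  rcases eq_or_ne c 0 with rfl | hc
  · simp [homEntropy]
  -- No sign is assumed, so the total can vanish with `p ≠ 0`. Since `Real.log 0 = 0`, the terms
  -- `log c` then fail to cancel one by one, but they cancel in the sum because `∑ p = 0`.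
  by_cases hS : ∑ b, p b = 0
  · unfold homEntropy
    rw [← Finset.mul_sum, hS, Finset.mul_sum]
    have h1 : ∀ a, c * p a * (Real.log (c * 0) - Real.log (c * p a)) =
        c * (p a * (Real.log 0 - Real.log (p a))) - (c * p a) * Real.log c := by
      intro a
      rcases eq_or_ne (p a) 0 with h | h
      · simp [h]
      · rw [Real.log_mul hc h, mul_zero, Real.log_zero]; ring
    simp_rw [h1]
    have h2 : ∑ a, c * p a * Real.log c = 0 := by
      rw [← Finset.sum_mul, ← Finset.mul_sum, hS]; simp
    rw [Finset.sum_sub_distrib, h2, sub_zero]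
  · have hcS : ∑ a, c * p a = c * ∑ a, p a := (Finset.mul_sum _ _ _).symm
    unfold homEntropy
    rw [Finset.mul_sum, hcS]
    refine Finset.sum_congr rfl fun a _ => ?_
    rcases eq_or_ne (p a) 0 with h | h
    · simp [h]
    · rw [Real.log_mul hc h, Real.log_mul hc hS]; ring

/-- Additivity over independent pairs; the total masses appear because the vectors are not
normalized. -/
theorem prod_mul {p : A → ℝ} {r : B → ℝ} (hp : ∀ a, 0 ≤ p a) (hr : ∀ b, 0 ≤ r b) :
    homEntropy (fun z : A × B => p z.1 * r z.2) =
      homEntropy p * ∑ b, r b + (∑ a, p a) * homEntropy r := by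
  have hS : ∑ z : A × B, p z.1 * r z.2 = (∑ a, p a) * ∑ b, r b := by
    rw [Fintype.sum_prod_type, Finset.sum_mul_sum]
  generalize hP : ∑ a, p a = P at hS ⊢
  generalize hR : ∑ b, r b = R at hS ⊢
  have e1 : homEntropy p * R = ∑ a, ∑ b, p a * (Real.log P - Real.log (p a)) * r b := by
    rw [← hR, homEntropy, hP, Finset.sum_mul_sum]
  have e2 : P * homEntropy r = ∑ a, ∑ b, p a * (r b * (Real.log R - Real.log (r b))) := by
    rw [← hP, homEntropy, hR, Finset.sum_mul_sum]
  rw [e1, e2, homEntropy, hS, Fintype.sum_prod_type, ← Finset.sum_add_distrib]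
  refine Finset.sum_congr rfl fun a _ => ?_
  rw [← Finset.sum_add_distrib]
  refine Finset.sum_congr rfl fun b _ => ?_
  rcases (hp a).eq_or_lt with h | h
  · simp [← h]
  rcases (hr b).eq_or_lt with h' | h'
  · simp [← h']
  have h1 : p a ≤ P := hP ▸
    Finset.single_le_sum (f := p) (fun b _ => hp b) (Finset.mem_univ a)
  have h2 : r b ≤ R := hR ▸
    Finset.single_le_sum (f := r) (fun b _ => hr b) (Finset.mem_univ b)
  rw [Real.log_mul (by linarith) (by linarith), Real.log_mul h.ne' h'.ne']
  ring

/-- Follows from `(x - y)² ≤ 2 x² + 2 y²` with `x = r a - m`, `y = r b - m`. The center `m` is left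
free because `mul_le` needs `√(T / S)`, which is not the mean of `√K` in general. -/
theorem variance_le {p : A → ℝ} (hp : ∀ a, 0 ≤ p a) (r : A → ℝ) (m : ℝ) :
    1 / (4 * ∑ a, p a) * ∑ a, ∑ b, p a * p b * (r a - r b) ^ 2 ≤ ∑ a, p a * (r a - m) ^ 2 := by
  rcases (Finset.sum_nonneg fun a (_ : a ∈ Finset.univ) => hp a).eq_or_lt with h | h
  · rw [← h]
    simpa using Finset.sum_nonneg fun a (_ : a ∈ Finset.univ) => mul_nonneg (hp a) (sq_nonneg _)
  · rw [one_div, inv_mul_le_iff₀ (by positivity)]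
    have h1 : ∑ a, ∑ b, p a * p b * (r a - r b) ^ 2 ≤
        ∑ a, ∑ b, (2 * (p a * (r a - m) ^ 2) * p b + p a * (2 * (p b * (r b - m) ^ 2))) := by
      refine Finset.sum_le_sum fun a _ => Finset.sum_le_sum fun b _ => ?_
      have := mul_nonneg (mul_nonneg (hp a) (hp b)) (sq_nonneg ((r a - m) + (r b - m)))
      nlinarith [this]
    refine h1.trans (le_of_eq ?_)
    simp_rw [Finset.sum_add_distrib, ← Finset.mul_sum, ← Finset.sum_mul, ← Finset.mul_sum]
    ring

/-- Gibbs' inequality for `p a * K a` against `p`, with a Hellinger type remainder. -/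
theorem mul_le {p K : A → ℝ} (hp : ∀ a, 0 ≤ p a) (hK : ∀ a, 0 ≤ K a) :
    homEntropy (fun a => p a * K a) ≤
      ∑ a, p a * K a * (Real.log (∑ b, p b) - Real.log (p a)) -
        1 / (4 * ∑ a, p a) * ∑ a, ∑ b, p a * p b * (√(K a) - √(K b)) ^ 2 := by
  set S := ∑ a, p a with hSdef
  set T := ∑ a, p a * K a with hTdef
  have hS0 : 0 ≤ S := Finset.sum_nonneg fun a _ => hp a
  have hT0 : 0 ≤ T := Finset.sum_nonneg fun a _ => mul_nonneg (hp a) (hK a)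
  have hv := variance_le hp (fun a => √(K a)) (√(T / S))
  -- The inequality `log z ≤ z - 1` is used at the square root `z = √(T / S) / √(K a)`. Completing
  -- the square leaves the Hellinger term, and a linear correction that sums to zero.
  have key : ∀ a, p a * K a * (Real.log T - Real.log (p a * K a)) ≤
      p a * K a * (Real.log S - Real.log (p a)) - p a * (√(K a) - √(T / S)) ^ 2 +
        (p a * (T / S) - p a * K a) := by
    intro a
    have hsT : √(T / S) ^ 2 = T / S := Real.sq_sqrt (by positivity)
    have hsK : √(K a) ^ 2 = K a := Real.sq_sqrt (hK a)
    rcases (hp a).eq_or_lt with h | h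
    · simp [← h]
    rcases (hK a).eq_or_lt with h' | h'
    · simp [← h', hsT]
    have hSp : 0 < S := h.trans_le
      (Finset.single_le_sum (f := p) (fun b _ => hp b) (Finset.mem_univ a))
    have hTp : 0 < T := (mul_pos h h').trans_le
      (Finset.single_le_sum (f := fun a => p a * K a) (fun b _ => mul_nonneg (hp b) (hK b))
        (Finset.mem_univ a))
    have hk : 0 < √(K a) := Real.sqrt_pos.2 h'
    have ht : 0 < √(T / S) := Real.sqrt_pos.2 (div_pos hTp hSp)
    have hlog : Real.log T - Real.log (p a * K a) - (Real.log S - Real.log (p a)) =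
        2 * Real.log (√(T / S) / √(K a)) := by
      rw [Real.log_div ht.ne' hk.ne', Real.log_sqrt (by positivity), Real.log_sqrt h'.le,
        Real.log_div hTp.ne' hSp.ne', Real.log_mul h.ne' h'.ne']
      ring
    have hle := Real.log_le_sub_one_of_pos (div_pos ht hk)
    have h3 : p a * K a * (Real.log T - Real.log (p a * K a) - (Real.log S - Real.log (p a))) ≤
        p a * K a * (2 * (√(T / S) / √(K a) - 1)) := by
      rw [hlog]
      exact mul_le_mul_of_nonneg_left (by linarith) (mul_pos h h').le
    have h4 : p a * K a * (2 * (√(T / S) / √(K a) - 1)) =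
        2 * p a * (√(K a) * √(T / S)) - 2 * p a * K a := by
      have : K a * (√(T / S) / √(K a)) = √(K a) * √(T / S) := by
        rw [← hsK, Real.sqrt_sq hk.le]
        field_simp
      linear_combination 2 * p a * this
    rw [h4] at h3
    linear_combination h3 + p a * hsK + p a * hsT
  have hsum := Finset.sum_le_sum fun a (_ : a ∈ Finset.univ) => key a
  have hz : ∑ a, (p a * (T / S) - p a * K a) = 0 := by
    rw [Finset.sum_sub_distrib, ← Finset.sum_mul, ← hSdef, ← hTdef]
    rcases hS0.eq_or_lt with h | h
    · have : T = 0 := by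
        have h0 := (Finset.sum_eq_zero_iff_of_nonneg fun a _ => hp a).1 h.symm
        exact Finset.sum_eq_zero fun a ha => by rw [h0 a ha, zero_mul]
      simp [this]
    · field_simp; ring
  rw [Finset.sum_add_distrib, Finset.sum_sub_distrib, hz] at hsum
  unfold homEntropy
  simp only [← hTdef]
  linarith

/-- The divergence of a vector from uniformity is at most a sum of squared Hellinger distances. -/
theorem card_sub_le {p : A → ℝ} (hp : ∀ a, 0 ≤ p a) :
    (∑ a, p a) * Real.log (Fintype.card A) - homEntropy p ≤ ∑ a, ∑ b, (√(p a) - √(p b)) ^ 2 := by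
  classical
  set S := ∑ a, p a with hSdef
  rcases (Finset.sum_nonneg fun a (_ : a ∈ Finset.univ) => hp a).eq_or_lt with h | hS
  · have h0 := (Finset.sum_eq_zero_iff_of_nonneg fun a _ => hp a).1 h.symm
    have h1 : homEntropy p = 0 := Finset.sum_eq_zero fun a ha => by rw [h0 a ha, zero_mul]
    rw [h1, hSdef, ← h]
    simpa using Finset.sum_nonneg fun a _ => Finset.sum_nonneg fun b _ => sq_nonneg _
  rw [← hSdef] at hS
  have hq : (0 : ℝ) < Fintype.card A := by
    rcases isEmpty_or_nonempty A with hA | hA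
    · simp [hSdef] at hS
    · exact_mod_cast Fintype.card_pos
  set q : ℝ := (Fintype.card A : ℝ)
  -- Divergence is at most chi-square, again by `log z ≤ z - 1`.
  have h1 : S * Real.log q - homEntropy p ≤ ∑ a, p a * (q * p a / S - 1) := by
    unfold homEntropy
    rw [hSdef, Finset.sum_mul, ← Finset.sum_sub_distrib, ← hSdef]
    refine Finset.sum_le_sum fun a _ => ?_
    rcases (hp a).eq_or_lt with h | h
    · simp [← h]
    have := Real.log_le_sub_one_of_pos (show 0 < q * p a / S by positivity)
    rw [Real.log_div (by positivity) hS.ne', Real.log_mul hq.ne' h.ne'] at this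
    nlinarith
  have h2 : ∑ a, p a * (q * p a / S - 1) = 1 / (2 * S) * ∑ a, ∑ b, (p a - p b) ^ 2 := by
    have e1 : ∀ a b, (p a - p b) ^ 2 = p a ^ 2 + p b ^ 2 - 2 * p a * p b := fun a b => by ring
    have e2 : ∑ a, p a * (q * p a / S - 1) = q / S * ∑ a, p a ^ 2 - S := by
      rw [Finset.mul_sum, hSdef, ← Finset.sum_sub_distrib, ← hSdef]
      exact Finset.sum_congr rfl fun a _ => by ring
    simp_rw [e2, e1, Finset.sum_sub_distrib, Finset.sum_add_distrib, ← Finset.mul_sum,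
      ← Finset.sum_mul, ← hSdef]
    simp only [Finset.sum_const, Finset.card_univ, nsmul_eq_mul, ← Finset.mul_sum, ← hSdef]
    field_simp
    ring
  refine h1.trans (h2.le.trans ?_)
  rw [Finset.mul_sum]
  refine Finset.sum_le_sum fun a _ => ?_
  rw [Finset.mul_sum]
  refine Finset.sum_le_sum fun b _ => ?_
  rcases eq_or_ne a b with rfl | hab
  · simp
  -- Needs `a ≠ b`. It gives `(√(p a) + √(p b))² ≤ 2 (p a + p b) ≤ 2 S`, which absorbs the factor `1
  -- / (2 S)`.
  have h3 : p a + p b ≤ S := by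
    rw [← Finset.sum_pair hab, hSdef]
    exact Finset.sum_le_sum_of_subset_of_nonneg (Finset.subset_univ _) fun i _ _ => hp i
  have ha := Real.sq_sqrt (hp a)
  have hb := Real.sq_sqrt (hp b)
  rw [one_div, inv_mul_le_iff₀ (by positivity)]
  have h4 : (p a - p b) ^ 2 = (√(p a) - √(p b)) ^ 2 * (√(p a) + √(p b)) ^ 2 := by
    nth_rewrite 1 [← ha, ← hb]; ring
  rw [h4, mul_comm]
  refine mul_le_mul_of_nonneg_right ?_ (sq_nonneg _)
  nlinarith [sq_nonneg (√(p a) - √(p b))]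

theorem le_card {p : A → ℝ} (hp : ∀ a, 0 ≤ p a) :
    homEntropy p ≤ (∑ a, p a) * Real.log (Fintype.card A) := by
  rcases isEmpty_or_nonempty A with hA | hA
  · simp [homEntropy]
  have hq : (0 : ℝ) < Fintype.card A := by exact_mod_cast Fintype.card_pos
  -- Gibbs against unit weights; the Hellinger remainder is dropped.
  have h := mul_le (p := fun _ : A => (1 : ℝ)) (K := p) (fun _ => zero_le_one) hp
  simp only [one_mul, Finset.sum_const, Finset.card_univ, nsmul_eq_mul, mul_one, Real.log_one,
    sub_zero, ← Finset.sum_mul] at h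
  refine h.trans (sub_le_self _ ?_)
  exact mul_nonneg (by positivity)
    (Finset.sum_nonneg fun a _ => Finset.sum_nonneg fun b _ => sq_nonneg _)

/-- The entropy is controlled by the collision probability. -/
theorem le_collision {p : A → ℝ} (hp : ∀ a, 0 ≤ p a) {t : ℝ} (ht : 0 < t) :
    homEntropy p ≤ Fintype.card A * t * (∑ a, p a) +
      1 / t * (1 / (∑ a, p a) * ∑ a, p a * (∑ b, p b - p a)) := by
  set S := ∑ a, p a with hSdef
  rcases (Finset.sum_nonneg fun a (_ : a ∈ Finset.univ) => hp a).eq_or_lt with h | hS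
  · have h0 := (Finset.sum_eq_zero_iff_of_nonneg fun a _ => hp a).1 h.symm
    have h1 : homEntropy p = 0 := Finset.sum_eq_zero fun a ha => by rw [h0 a ha, zero_mul]
    rw [h1, hSdef, ← h]
    simp
  rw [← hSdef] at hS
  have h1 : (Fintype.card A : ℝ) * t * S = ∑ a : A, t * S := by
    simp [mul_assoc]
  rw [h1, Finset.mul_sum Finset.univ _ (1 / S), Finset.mul_sum Finset.univ _ (1 / t),
    ← Finset.sum_add_distrib]
  unfold homEntropy
  refine Finset.sum_le_sum fun a _ => ?_
  rw [← hSdef]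
  rcases (hp a).eq_or_lt with h | h
  · simp [← h]; positivity
  have haS : p a ≤ S := Finset.single_le_sum (f := p) (fun b _ => hp b) (Finset.mem_univ a)
  set s := √(p a / S) with hs
  have hs2 : s ^ 2 = p a / S := Real.sq_sqrt (by positivity)
  have hs0 : 0 < s := Real.sqrt_pos.2 (by positivity)
  have hs1 : s ≤ 1 := by rw [hs]; exact Real.sqrt_le_one.2 ((div_le_one hS).2 haS)
  have hpa : p a = S * s ^ 2 := by rw [hs2]; field_simp
  have hlog : Real.log S - Real.log (p a) = 2 * Real.log s⁻¹ := by
    rw [hpa, Real.log_mul hS.ne' (by positivity), Real.log_pow, Real.log_inv]; push_cast; ring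
  have hle := Real.log_le_sub_one_of_pos (inv_pos.2 hs0)
  rw [hlog]
  have e1 : p a * (2 * Real.log s⁻¹) ≤ S * (2 * (s * (1 - s))) := by
    have : S * (2 * (s * (1 - s))) = p a * (2 * (s⁻¹ - 1)) := by
      rw [hpa]; field_simp
    rw [this]
    exact mul_le_mul_of_nonneg_left (by linarith) (hp a)
  have e2 : 1 / t * (1 / S * (p a * (S - p a))) = S * (s ^ 2 * (1 - s ^ 2) / t) := by
    rw [hpa]; field_simp
  rw [e2, mul_comm t S, ← mul_add]
  refine e1.trans (mul_le_mul_of_nonneg_left ?_ hS.le)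
  -- A linearized Cauchy–Schwarz inequality: `t` stays free so that it can be chosen after summing
  -- over the outputs. The final comparison is `(1 - s)² ≤ 1 - s²`.
  have e3 : 2 * (s * (1 - s)) ≤ t + (s * (1 - s)) ^ 2 / t := by
    rw [← sub_nonneg]
    have : t + (s * (1 - s)) ^ 2 / t - 2 * (s * (1 - s)) = (t - s * (1 - s)) ^ 2 / t := by
      field_simp; ring
    rw [this]; positivity
  refine e3.trans (add_le_add_right (div_le_div_of_nonneg_right ?_ ht.le) t)
  nlinarith [mul_nonneg (pow_pos hs0 2).le (mul_nonneg hs0.le (sub_nonneg.2 hs1))]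

end homEntropy

/-! ### The chain rule -/

namespace homEntropy

/-- Chain rule: the conditional entropies of the coordinates given the preceding ones sum up to the
joint entropy. -/
theorem sum_coordinates {X : Type u} [Fintype X] [DecidableEq X] {ℓ : ℕ} (F : (Fin ℓ → X) → ℝ) :
    ∑ i : Fin ℓ, ∑ p : {j : Fin ℓ // j < i} → X, homEntropy (fun a => ∑ u : Fin ℓ → X
      with u i = a ∧ ∀ j : {j : Fin ℓ // j < i}, u j = p j, F u) = homEntropy F := by
  -- `M m u` is the mass of the cylinder fixed by the first `m` entries of `u`. The `i`-th
  -- conditional entropy is the `F`-weighted sum of `log M i - log M (i + 1)`; these telescope from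
  -- the total mass to `F u`.
  set M : ℕ → (Fin ℓ → X) → ℝ := fun m u =>
    ∑ v : Fin ℓ → X with ∀ j : Fin ℓ, (j : ℕ) < m → v j = u j, F v with hM
  have key : ∀ i : Fin ℓ, ∑ p : {j : Fin ℓ // j < i} → X, homEntropy (fun a => ∑ u : Fin ℓ → X
      with u i = a ∧ ∀ j : {j : Fin ℓ // j < i}, u j = p j, F u) =
      ∑ u, F u * (Real.log (M i u) - Real.log (M (i + 1) u)) := by
    intro i
    have hfib : ∀ φ : (Fin ℓ → X) → ℝ, ∑ p : {j : Fin ℓ // j < i} → X, ∑ a : X,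
        ∑ u : Fin ℓ → X with u i = a ∧ ∀ j : {j : Fin ℓ // j < i}, u j = p j, φ u =
        ∑ u, φ u := by
      intro φ
      rw [← Fintype.sum_prod_type', ← Finset.sum_fiberwise Finset.univ
        (fun u : Fin ℓ → X => ((fun j : {j : Fin ℓ // j < i} => u j), u i)) φ]
      refine Finset.sum_congr rfl fun z _ => Finset.sum_congr ?_ fun _ _ => rfl
      ext u
      simp only [Finset.mem_filter, Finset.mem_univ, true_and, Prod.ext_iff, funext_iff]
      exact and_comm
    rw [← hfib]
    refine Finset.sum_congr rfl fun p _ => ?_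
    unfold homEntropy
    refine Finset.sum_congr rfl fun a _ => ?_
    rw [Finset.sum_mul]
    refine Finset.sum_congr rfl fun u hu => ?_
    simp only [Finset.mem_filter, Finset.mem_univ, true_and] at hu
    obtain ⟨hua, hup⟩ := hu
    congr 3
    · simp only [hM]
      rw [← Finset.sum_fiberwise (Finset.univ.filter fun v : Fin ℓ → X =>
        ∀ j : Fin ℓ, (j : ℕ) < i → v j = u j) (fun v => v i) F]
      refine Finset.sum_congr rfl fun b _ => Finset.sum_congr ?_ fun _ _ => rfl
      ext v
      simp only [Finset.mem_filter, Finset.mem_univ, true_and]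
      refine ⟨fun h => ⟨fun j hj => ?_, h.1⟩, fun h => ⟨h.2, fun j => ?_⟩⟩
      · rw [h.2 ⟨j, hj⟩, hup ⟨j, hj⟩]
      · rw [h.1 j j.2, hup j]
    · refine Finset.sum_congr ?_ fun _ _ => rfl
      ext v
      simp only [Finset.mem_filter, Finset.mem_univ, true_and]
      refine ⟨fun h j hj => ?_, fun h => ⟨?_, fun j => ?_⟩⟩
      · rcases Nat.lt_succ_iff_lt_or_eq.1 hj with hj | hj
        · rw [h.2 ⟨j, hj⟩, hup ⟨j, hj⟩]
        · rw [Fin.ext hj, h.1, hua]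
      · rw [h i (Nat.lt_succ_self _), hua]
      · rw [h j (Nat.lt_succ_of_lt j.2), hup j]
  rw [Finset.sum_congr rfl fun i _ => key i, Finset.sum_comm]
  unfold homEntropy
  refine Finset.sum_congr rfl fun u _ => ?_
  rw [← Finset.mul_sum]
  congr 1
  rw [Fin.sum_univ_eq_sum_range fun m => Real.log (M m u) - Real.log (M (m + 1) u),
    Finset.sum_range_sub' fun m => Real.log (M m u)]
  congr 2
  · simp [hM]
  · have : (Finset.univ.filter fun v : Fin ℓ → X => ∀ j : Fin ℓ, (j : ℕ) < ℓ → v j = u j) = {u} := by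
      ext v; simp [funext_iff]
    simp only [hM]
    rw [this, Finset.sum_singleton]

end homEntropy

/-! ### Equivocation, symmetric capacity and their conservation -/

namespace DMC

variable {X : Type u} [Fintype X]

/-- The equivocation `∑ y, homEntropy (W(y ∣ ·))`, which is `|X|` times the conditional entropy
in nats of a uniform input given the output. -/
noncomputable def equivocation (W : DMC X) : ℝ :=
  ∑' y, homEntropy fun x => W.prob x y

theorem hasSum_sum_prob (W : DMC X) : HasSum (fun y => ∑ x, W.prob x y) (Fintype.card X) := by
  have := hasSum_sum fun x (_ : x ∈ Finset.univ) => W.hasSum_prob x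
  simpa using this

theorem homEntropy_prob_nonneg (W : DMC X) (y : W.Out) : 0 ≤ homEntropy fun x => W.prob x y :=
  homEntropy.nonneg fun x => W.prob_nonneg x y

theorem summable_homEntropy (W : DMC X) : Summable fun y => homEntropy fun x => W.prob x y :=
  Summable.of_nonneg_of_le W.homEntropy_prob_nonneg
    (fun y => homEntropy.le_card fun x => W.prob_nonneg x y)
    (W.hasSum_sum_prob.summable.mul_right _)

theorem equivocation_nonneg (W : DMC X) : 0 ≤ W.equivocation :=
  tsum_nonneg W.homEntropy_prob_nonneg

theorem equivocation_le (W : DMC X) :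
    W.equivocation ≤ Fintype.card X * Real.log (Fintype.card X) := by
  rw [← (W.hasSum_sum_prob.mul_right _).tsum_eq]
  exact W.summable_homEntropy.tsum_le_tsum (fun y => homEntropy.le_card fun x => W.prob_nonneg x y)
    (W.hasSum_sum_prob.summable.mul_right _)

/-- Termwise, `log_q (q W / S) = 1 - (log S - log W) / log q`, where `S` is the sum of `W` over the
inputs. Both resulting series converge, so capacity questions become equivocation questions. -/
theorem symCapacity_eq (hq : 1 < Fintype.card X) (W : DMC X) :
    W.symCapacity = 1 - W.equivocation / (Fintype.card X * Real.log (Fintype.card X)) := by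
  set q : ℝ := (Fintype.card X : ℝ) with hqdef
  have hq1 : (1 : ℝ) < q := by rw [hqdef]; exact_mod_cast hq
  have hq0 : 0 < q := by linarith
  have hlq : 0 < Real.log q := Real.log_pos hq1
  have hterm : ∀ x y, 1 / q * W.prob x y *
      Real.logb q (W.prob x y / (1 / q * ∑ x', W.prob x' y)) =
      1 / q * W.prob x y - 1 / (q * Real.log q) *
        (W.prob x y * (Real.log (∑ x', W.prob x' y) - Real.log (W.prob x y))) := by
    intro x y
    rcases (W.prob_nonneg x y).eq_or_lt with h | h
    · simp [← h]
    have hS : 0 < ∑ x', W.prob x' y := h.trans_le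
      (Finset.single_le_sum (f := fun x' => W.prob x' y) (fun b _ => W.prob_nonneg b y)
        (Finset.mem_univ x))
    rw [Real.logb, Real.log_div h.ne' (by positivity), Real.log_mul (by positivity) hS.ne',
      one_div, Real.log_inv]
    field_simp
    ring
  have hsum : ∀ x, Summable fun y =>
      W.prob x y * (Real.log (∑ x', W.prob x' y) - Real.log (W.prob x y)) := fun x =>
    Summable.of_nonneg_of_le
      (fun y => homEntropy.term_nonneg (fun x => W.prob_nonneg x y) x)
      (fun y => Finset.single_le_sum (f := fun x => W.prob x y *
        (Real.log (∑ x', W.prob x' y) - Real.log (W.prob x y)))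
        (fun b _ => homEntropy.term_nonneg (fun x => W.prob_nonneg x y) b) (Finset.mem_univ x))
      W.summable_homEntropy
  have hx : ∀ x, ∑' y, 1 / q * W.prob x y *
      Real.logb q (W.prob x y / (1 / q * ∑ x', W.prob x' y)) =
      1 / q - 1 / (q * Real.log q) *
        ∑' y, W.prob x y * (Real.log (∑ x', W.prob x' y) - Real.log (W.prob x y)) := by
    intro x
    simp_rw [hterm]
    rw [((W.hasSum_prob x).summable.mul_left _).tsum_sub ((hsum x).mul_left _), tsum_mul_left,
      tsum_mul_left, (W.hasSum_prob x).tsum_eq, mul_one]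
  unfold symCapacity equivocation homEntropy
  rw [Finset.sum_congr rfl fun x _ => hx x, Finset.sum_sub_distrib, ← Finset.mul_sum,
    Summable.tsum_finsetSum fun x _ => hsum x]
  simp only [Finset.sum_const, Finset.card_univ, nsmul_eq_mul, ← hqdef]
  field_simp

theorem symCapacity_mem_Icc (hq : 1 < Fintype.card X) (W : DMC X) :
    W.symCapacity ∈ Set.Icc (0 : ℝ) 1 := by
  have hq1 : (1 : ℝ) < Fintype.card X := by exact_mod_cast hq
  have hpos : 0 < (Fintype.card X : ℝ) * Real.log (Fintype.card X) :=
    mul_pos (by linarith) (Real.log_pos hq1)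
  rw [symCapacity_eq hq]
  have h1 := (div_le_one hpos).2 W.equivocation_le
  have h2 := div_nonneg W.equivocation_nonneg hpos.le
  constructor <;> linarith

theorem hasSum_sum_powProb [DecidableEq X] (W : DMC X) (n : ℕ) :
    HasSum (fun y : Fin n → W.Out => ∑ x : Fin n → X, W.powProb x y) (Fintype.card X ^ n : ℝ) := by
  have := hasSum_sum fun x (_ : x ∈ (Finset.univ : Finset (Fin n → X))) => W.hasSum_powProb x
  simpa using this

/-- Each of the `n` coordinates contributes `E(W)`, and each of the other `n - 1` contributes its
total mass `q`. -/
theorem hasSum_homEntropy_powProb [DecidableEq X] (W : DMC X) (n : ℕ) :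
    HasSum (fun y : Fin n → W.Out => homEntropy fun x : Fin n → X => W.powProb x y)
      (n * Fintype.card X ^ (n - 1) * W.equivocation) := by
  induction n with
  | zero =>
    have : (fun y : Fin 0 → W.Out => homEntropy fun x : Fin 0 → X => W.powProb x y) =
        fun _ => 0 := by
      funext y; simp [homEntropy, powProb]
    rw [this]
    simp
  | succ n ih =>
    rw [← (Fin.consEquiv fun _ => W.Out).hasSum_iff]
    have e : ((fun y : Fin (n + 1) → W.Out => homEntropy fun x : Fin (n + 1) → X =>
        W.powProb x y) ∘ (Fin.consEquiv fun _ => W.Out)) = fun z : W.Out × (Fin n → W.Out) =>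
        (homEntropy fun x => W.prob x z.1) * (∑ x, W.powProb x z.2) +
        (∑ x, W.prob x z.1) * homEntropy fun x : Fin n → X => W.powProb x z.2 := by
      funext z
      rw [← homEntropy.prod_mul (fun x => W.prob_nonneg x z.1)
        (fun x => W.powProb_nonneg x z.2), Function.comp_apply,
        ← homEntropy.comp_equiv (Fin.consEquiv fun _ => X)]
      congr 1
      funext w
      simp [powProb, Fin.prod_univ_succ]
    rw [e]
    have hE : HasSum (fun y => homEntropy fun x => W.prob x y) W.equivocation :=
      W.summable_homEntropy.hasSum
    have hP := W.hasSum_sum_powProb n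
    have n1 : ∀ y : Fin n → W.Out, 0 ≤ ∑ x : Fin n → X, W.powProb x y := fun y =>
      Finset.sum_nonneg fun x _ => W.powProb_nonneg x y
    have n2 : ∀ y, 0 ≤ ∑ x, W.prob x y := fun y => Finset.sum_nonneg fun x _ => W.prob_nonneg x y
    have n3 : ∀ y : Fin n → W.Out, 0 ≤ homEntropy fun x : Fin n → X => W.powProb x y := fun y =>
      homEntropy.nonneg fun x => W.powProb_nonneg x y
    have s1 := hE.summable.mul_of_nonneg hP.summable W.homEntropy_prob_nonneg n1
    have s2 := W.hasSum_sum_prob.summable.mul_of_nonneg ih.summable n2 n3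
    have h1 := hE.mul hP s1
    have h2 := HasSum.mul W.hasSum_sum_prob ih s2
    -- For `n = 0` the truncated exponent `n - 1` is harmless, as its coefficient vanishes.
    have e2 : ((n + 1 : ℕ) : ℝ) * (Fintype.card X : ℝ) ^ (n + 1 - 1) * W.equivocation =
        W.equivocation * (Fintype.card X : ℝ) ^ n +
          Fintype.card X * (n * (Fintype.card X : ℝ) ^ (n - 1) * W.equivocation) := by
      rcases n with _ | n
      · simp
      · simp only [Nat.add_sub_cancel]
        push_cast
        ring
    rw [e2]
    exact h1.add h2

variable [DecidableEq X] {ℓ : ℕ}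

/-- The joint weight of the output `y`, of the inputs before `i` and of the input `a` at `i`. -/
noncomputable def prefixSum (g : (Fin ℓ → X) → (Fin ℓ → X)) (W : DMC X) (i : Fin ℓ)
    (p : {j : Fin ℓ // j < i} → X) (y : Fin ℓ → W.Out) (a : X) : ℝ :=
  ∑ u : Fin ℓ → X with u i = a ∧ ∀ j : {j : Fin ℓ // j < i}, u j = p j, W.powProb (g u) y

theorem prefixSum_nonneg (g : (Fin ℓ → X) → (Fin ℓ → X)) (W : DMC X) (i : Fin ℓ)
    (p : {j : Fin ℓ // j < i} → X) (y : Fin ℓ → W.Out) (a : X) : 0 ≤ W.prefixSum g i p y a :=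
  Finset.sum_nonneg fun _ _ => W.powProb_nonneg _ _

theorem homEntropy_subchannel_prob (g : (Fin ℓ → X) → (Fin ℓ → X)) (W : DMC X) (i : Fin ℓ)
    (z : (W.subchannel g i).Out) : (homEntropy fun x => (W.subchannel g i).prob x z) =
      1 / (Fintype.card X : ℝ) ^ (ℓ - 1) * homEntropy (W.prefixSum g i z.2 z.1) := by
  rw [← homEntropy.const_mul]
  rfl

theorem summable_homEntropy_prefixSum [Nonempty X] (g : (Fin ℓ → X) → (Fin ℓ → X)) (W : DMC X)
    (i : Fin ℓ) : Summable fun z : (Fin ℓ → W.Out) × ({j : Fin ℓ // j < i} → X) =>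
      homEntropy (W.prefixSum g i z.2 z.1) := by
  have h := (W.subchannel g i).summable_homEntropy
  simp_rw [homEntropy_subchannel_prob] at h
  exact (summable_mul_left_iff (by positivity)).1 h

theorem equivocation_subchannel [Nonempty X] (g : (Fin ℓ → X) → (Fin ℓ → X)) (W : DMC X)
    (i : Fin ℓ) : (W.subchannel g i).equivocation = 1 / (Fintype.card X : ℝ) ^ (ℓ - 1) *
      ∑ p : {j : Fin ℓ // j < i} → X, ∑' y : Fin ℓ → W.Out, homEntropy (W.prefixSum g i p y) := by
  have hs := W.summable_homEntropy_prefixSum g i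
  unfold equivocation
  simp_rw [homEntropy_subchannel_prob]
  rw [tsum_mul_left]
  congr 1
  have h1 := hs.tsum_prod
  refine Eq.trans h1 ?_
  simp_rw [tsum_fintype]
  exact Summable.tsum_finsetSum fun p _ => (hs.comp_injective (i := fun y => (y, p))
    fun _ _ h => (Prod.mk.inj h).1)

/-- Conservation of the equivocation under an invertible kernel. -/
theorem sum_equivocation_subchannel [Nonempty X] {g : (Fin ℓ → X) → (Fin ℓ → X)}
    (hg : Function.Bijective g) (W : DMC X) :
    ∑ i, (W.subchannel g i).equivocation = ℓ * W.equivocation := by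
  have hs : ∀ (i : Fin ℓ) (p : {j : Fin ℓ // j < i} → X),
      Summable fun y => homEntropy (W.prefixSum g i p y) := fun i p =>
    (W.summable_homEntropy_prefixSum g i).comp_injective
      (i := fun y => (y, p)) fun _ _ h => (Prod.mk.inj h).1
  simp_rw [equivocation_subchannel, ← Finset.mul_sum]
  have h1 : ∀ i : Fin ℓ, ∑ p : {j : Fin ℓ // j < i} → X, ∑' y : Fin ℓ → W.Out,
      homEntropy (W.prefixSum g i p y) = ∑' y : Fin ℓ → W.Out,
      ∑ p : {j : Fin ℓ // j < i} → X, homEntropy (W.prefixSum g i p y) := fun i =>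
    (Summable.tsum_finsetSum fun p _ => hs i p).symm
  rw [Finset.sum_congr rfl fun i _ => h1 i,
    ← Summable.tsum_finsetSum fun i _ => summable_sum fun p _ => hs i p]
  -- For each fixed output: the chain rule in the inputs `u`, then the bijection `g` to pass from
  -- `u` to the codeword.
  have h2 : ∀ y, ∑ i : Fin ℓ, ∑ p : {j : Fin ℓ // j < i} → X,
      homEntropy (W.prefixSum g i p y) = homEntropy fun x => W.powProb x y := fun y => by
    rw [← homEntropy.comp_equiv (Equiv.ofBijective g hg)]
    exact homEntropy.sum_coordinates fun u => W.powProb (g u) y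
  simp_rw [h2]
  rw [(W.hasSum_homEntropy_powProb ℓ).tsum_eq]
  have : (Fintype.card X : ℝ) ≠ 0 := by exact_mod_cast Fintype.card_ne_zero
  field_simp

theorem sum_symCapacity_subchannel (hq : 1 < Fintype.card X) {g : (Fin ℓ → X) → (Fin ℓ → X)}
    (hg : Function.Bijective g) (W : DMC X) :
    ∑ i, (W.subchannel g i).symCapacity = ℓ * W.symCapacity := by
  have : Nonempty X := Fintype.card_pos_iff.1 (by omega)
  simp_rw [symCapacity_eq hq]
  rw [Finset.sum_sub_distrib, ← Finset.sum_div, sum_equivocation_subchannel hg]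
  simp
  ring

end DMC

/-! ### Linear algebra of nontrivial kernels -/

section Kernel

variable {X : Type u} [Field X] {ℓ : ℕ}

open Classical in
/-- The columns in which some row of `G` with index at least `m` does not vanish. -/
noncomputable def lowerSupport (G : Matrix (Fin ℓ) (Fin ℓ) X) (m : ℕ) : Finset (Fin ℓ) :=
  Finset.univ.filter fun j => ∃ k : Fin ℓ, m ≤ k ∧ G k j ≠ 0

theorem mem_lowerSupport {G : Matrix (Fin ℓ) (Fin ℓ) X} {m : ℕ} {j : Fin ℓ} :
    j ∈ lowerSupport G m ↔ ∃ k : Fin ℓ, m ≤ k ∧ G k j ≠ 0 := by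
  simp [lowerSupport]

/-- The last `ℓ - m` rows are independent and vanish off these columns, so they stay independent
when restricted to them. -/
theorem le_card_lowerSupport {G : Matrix (Fin ℓ) (Fin ℓ) X} (hG : IsUnit G.det) (m : ℕ) :
    ℓ - m ≤ (lowerSupport G m).card := by
  classical
  have hrow : LinearIndependent X G.row :=
    Matrix.linearIndependent_rows_of_isUnit ((Matrix.isUnit_iff_isUnit_det G).2 hG)
  have hli : LinearIndependent X fun (k : {k : Fin ℓ // m ≤ (k : ℕ)}) (j : lowerSupport G m) =>
      G k j := by
    have h1 := hrow.comp (fun k : {k : Fin ℓ // m ≤ (k : ℕ)} => (k : Fin ℓ))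
      Subtype.val_injective
    rw [Fintype.linearIndependent_iff] at h1 ⊢
    intro c hc
    refine h1 c ?_
    funext j
    by_cases hj : j ∈ lowerSupport G m
    · have := congrFun hc ⟨j, hj⟩
      simpa [Finset.sum_apply] using this
    · rw [mem_lowerSupport] at hj
      push Not at hj
      simp only [Finset.sum_apply, Pi.smul_apply, Function.comp_apply, Pi.zero_apply, smul_eq_mul]
      refine Finset.sum_eq_zero fun k _ => ?_
      rw [show G.row k j = G k j from rfl, hj k k.2, mul_zero]
  have hcard := hli.fintype_card_le_finrank
  rw [Module.finrank_fintype_fun_eq_card, Fintype.card_coe] at hcard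
  refine le_trans (le_of_eq ?_) hcard
  rw [Fintype.card_subtype]
  have := Fin.card_filter_val_lt (n := ℓ) (m := m)
  have h2 := Finset.card_filter_add_card_filter_not (s := (Finset.univ : Finset (Fin ℓ)))
    (fun k => (k : ℕ) < m)
  simp only [not_lt, Finset.card_univ, Fintype.card_fin] at h2
  omega

/-- A kernel that is not trivial has a row with two nonzero entries below which both columns
vanish. -/
theorem exists_row_of_not_isTrivialKernel {G : Matrix (Fin ℓ) (Fin ℓ) X} (hG : IsUnit G.det)
    (h : ¬ IsTrivialKernel G) : ∃ i j₁ j₂ : Fin ℓ, j₁ ≠ j₂ ∧ G i j₁ ≠ 0 ∧ G i j₂ ≠ 0 ∧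
      ∀ k, i < k → G k j₁ = 0 ∧ G k j₂ = 0 := by
  classical
  by_contra hcon
  push Not at hcon
  refine h ?_
  -- A column leaving the support between `i` and `i + 1` has its last nonzero entry in row `i`.
  have hsd : ∀ (i j : Fin ℓ), j ∈ lowerSupport G i \ lowerSupport G (i + 1) →
      G i j ≠ 0 ∧ ∀ k, i < k → G k j = 0 := by
    intro i j hj
    rw [Finset.mem_sdiff, mem_lowerSupport, mem_lowerSupport] at hj
    obtain ⟨⟨k, hk, hkj⟩, hn⟩ := hj
    push Not at hn
    refine ⟨?_, fun k hk => hn k hk⟩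
    rcases hk.eq_or_lt with h' | h'
    · rwa [Fin.ext h']
    · exact absurd (hn k h') hkj
  -- Two columns leaving at the same row would be the pair excluded by `hcon`.
  have hstep : ∀ i : Fin ℓ,
      (lowerSupport G i).card ≤ (lowerSupport G (i + 1)).card + 1 := by
    intro i
    have h1 : (lowerSupport G i \ lowerSupport G (i + 1)).card ≤ 1 := by
      rw [Finset.card_le_one]
      intro a ha b hb
      by_contra hab
      obtain ⟨k, hk, hne⟩ := hcon i a b hab (hsd i a ha).1 (hsd i b hb).1
      exact hne ((hsd i a ha).2 k hk) ((hsd i b hb).2 k hk)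
    have h2 := Finset.le_card_sdiff (lowerSupport G (i + 1)) (lowerSupport G i)
    omega
  have hle : ∀ n m : ℕ, m + n = ℓ → (lowerSupport G m).card ≤ n := by
    intro n
    induction n with
    | zero =>
      intro m hm
      rw [Nat.le_zero, Finset.card_eq_zero, Finset.eq_empty_iff_forall_notMem]
      intro j hj
      obtain ⟨k, hk, -⟩ := mem_lowerSupport.1 hj
      have := k.2
      omega
    | succ n ih =>
      intro m hm
      have h1 := hstep ⟨m, by omega⟩
      have h2 := ih (m + 1) (by omega)
      exact h1.trans (Nat.succ_le_succ h2)
  -- If no column left at `i`, the upper bound `ℓ - (i + 1)` would contradict the lower bound `ℓ -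
  -- i` from independence of rows.
  have hne : ∀ i : Fin ℓ, ∃ j, j ∈ lowerSupport G i \ lowerSupport G (i + 1) := by
    intro i
    by_contra hno
    have hsub : lowerSupport G i ⊆ lowerSupport G (i + 1) := by
      rw [← Finset.sdiff_eq_empty_iff_subset, Finset.eq_empty_iff_forall_notMem]
      exact fun j hj => hno ⟨j, hj⟩
    have h1 := Finset.card_le_card hsub
    have h2 := le_card_lowerSupport hG i
    have h3 := hle (ℓ - (i + 1)) (i + 1) (by omega)
    omega
  choose f hf using hne
  have hinj : Function.Injective f := by
    intro a b hab
    rcases lt_trichotomy a b with hlt | heq | hlt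
    · exact absurd ((hsd a _ (hf a)).2 b hlt) (hab ▸ (hsd b _ (hf b)).1)
    · exact heq
    · exact absurd ((hsd b _ (hf b)).2 a hlt) (hab ▸ (hsd a _ (hf a)).1)
  -- Column `σ j` has its last nonzero entry in row `j`, so permuting the columns by `σ` makes `G`
  -- upper triangular, and `D = 1` serves as the diagonal factor.
  set σ : Equiv.Perm (Fin ℓ) := Equiv.ofBijective f (Finite.injective_iff_bijective.1 hinj)
  have hGV : G = G.submatrix id σ * 1 * σ.permMatrix X := by
    ext i j
    rw [mul_one]
    simp [Equiv.Perm.permMatrix, PEquiv.mul_toMatrix_toPEquiv]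
  refine ⟨G.submatrix id σ, 1, σ, ?_, fun i j hji => (hsd j _ (hf j)).2 i hji,
    Matrix.isDiag_one, hGV⟩
  rw [hGV, mul_one, Matrix.det_mul] at hG
  exact isUnit_of_mul_isUnit_left hG

/-- Distinct columns of an invertible matrix are not proportional. -/
theorem exists_sub_mul_ne_zero {G : Matrix (Fin ℓ) (Fin ℓ) X} (hG : IsUnit G.det)
    {j₁ j₂ : Fin ℓ} (hj : j₁ ≠ j₂) (b : X) : ∃ k, G k j₂ - b * G k j₁ ≠ 0 := by
  by_contra hcon
  push Not at hcon
  have hinj := Matrix.mulVec_injective_of_isUnit ((Matrix.isUnit_iff_isUnit_det G).2 hG)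
  have h0 : (Pi.single j₂ 1 - b • Pi.single j₁ 1 : Fin ℓ → X) = 0 := by
    refine hinj ?_
    funext k
    rw [Matrix.mulVec_sub, Matrix.mulVec_smul]
    simpa using hcon k
  have := congrFun h0 j₂
  simp [hj.symm] at this

/-- A nonzero linear functional on `X^ℓ` is equidistributed. -/
theorem card_mul_sum_dotProduct [Fintype X] [DecidableEq X] {c : Fin ℓ → X} {k : Fin ℓ}
    (hk : c k ≠ 0) (Φ : X → ℝ) : (Fintype.card X : ℝ) * ∑ u : Fin ℓ → X, Φ (u ⬝ᵥ c) =
      (Fintype.card X : ℝ) ^ ℓ * ∑ s, Φ s := by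
  -- Translating `u` by `t` in coordinate `k` permutes the inputs; averaging over `t` then runs
  -- through all values of the functional.
  have h1 : ∀ t : X, ∑ u : Fin ℓ → X, Φ (u ⬝ᵥ c) = ∑ u : Fin ℓ → X, Φ (u ⬝ᵥ c + t * c k) := by
    intro t
    rw [← Equiv.sum_comp (Equiv.addRight (Pi.single k t : Fin ℓ → X)) fun u => Φ (u ⬝ᵥ c)]
    simp [add_dotProduct]
  have h2 : ∀ u : Fin ℓ → X, ∑ t, Φ (u ⬝ᵥ c + t * c k) = ∑ s, Φ s := fun u =>
    ((Equiv.mulRight₀ (c k) hk).trans (Equiv.addLeft (u ⬝ᵥ c))).sum_comp Φ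
  have h3 := Finset.sum_congr rfl fun t (_ : t ∈ (Finset.univ : Finset X)) => h1 t
  have h4 := (h3.trans Finset.sum_comm).trans (Finset.sum_congr rfl fun u _ => h2 u)
  simpa using h4

end Kernel

/-- Squared differences along a shift control all squared differences, in prime cardinality. -/
theorem sq_sub_le_of_prime_card {X : Type u} [Field X] [Fintype X] (hq : (Fintype.card X).Prime)
    {d : X} (hd : d ≠ 0) (r : X → ℝ) (x x' : X) :
    (r x - r x') ^ 2 ≤ (Fintype.card X : ℝ) ^ 2 * ∑ z, (r z - r (z + d)) ^ 2 := by
  set A := ∑ z, (r z - r (z + d)) ^ 2 with hA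
  have hA0 : 0 ≤ A := Finset.sum_nonneg fun _ _ => sq_nonneg _
  have hstep : ∀ z, |r z - r (z + d)| ≤ √A := fun z => Real.abs_le_sqrt
    (Finset.single_le_sum (f := fun z => (r z - r (z + d)) ^ 2) (fun _ _ => sq_nonneg _)
      (Finset.mem_univ z))
  have hmul : ∀ n : ℕ, |r x - r (x + n • d)| ≤ n * √A := by
    intro n
    induction n with
    | zero => simp
    | succ n ih =>
      have h1 := abs_sub_le (r x) (r (x + n • d)) (r (x + (n + 1) • d))
      have h2 := hstep (x + n • d)
      rw [add_assoc, ← succ_nsmul] at h2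
      push_cast
      linarith
  have : Fact (Fintype.card X).Prime := ⟨hq⟩
  -- Primality enters here: `d` generates the additive group, so `x'` is reached from `x` in at most
  -- `q` steps of length at most `√A`.
  have hmem : x' - x ∈ AddSubgroup.zmultiples d :=
    mem_zmultiples_of_prime_card (Nat.card_eq_fintype_card) hd
  have hord : addOrderOf d ≤ Fintype.card X := addOrderOf_le_card_univ
  classical
  obtain ⟨n, hn, hnd⟩ := Finset.mem_image.1 (mem_zmultiples_iff_mem_range_addOrderOf.1 hmem)
  have hn' : n ≤ Fintype.card X := (Finset.mem_range.1 hn).le.trans hord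
  have h3 := hmul n
  rw [show n • d = x' - x from hnd, add_sub_cancel] at h3
  have h4 : |r x - r x'| ≤ Fintype.card X * √A := h3.trans
    (mul_le_mul_of_nonneg_right (by exact_mod_cast hn') (Real.sqrt_nonneg _))
  have h5 := pow_le_pow_left₀ (abs_nonneg _) h4 2
  rwa [sq_abs, mul_pow, Real.sq_sqrt hA0] at h5

/-! ### Superadditivity and conditioning -/

namespace homEntropy

variable {A K L R : Type*} [Fintype A]

theorem summable_of_sum {v : K → A → ℝ} (hv : ∀ k a, 0 ≤ v k a)
    (hs : ∀ a, Summable fun k => v k a) : Summable fun k => homEntropy (v k) :=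
  Summable.of_nonneg_of_le (fun k => nonneg (hv k)) (fun k => le_card (hv k))
    ((summable_sum fun a _ => hs a).mul_right _)

/-- Superadditivity of the entropy. -/
theorem tsum_le {v : K → A → ℝ} {w : A → ℝ} (hv : ∀ k a, 0 ≤ v k a)
    (hw : ∀ a, HasSum (fun k => v k a) (w a)) : ∑' k, homEntropy (v k) ≤ homEntropy w := by
  have hw0 : ∀ a, 0 ≤ w a := fun a => (hw a).nonneg fun k => hv k a
  -- The density `v / w` survives division by zero, since `w a = 0` forces every `v k a` to vanish.
  have hvw : ∀ k a, v k a = w a * (v k a / w a) := by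
    intro k a
    rcases eq_or_ne (w a) 0 with h | h
    · have := (hasSum_zero_iff_of_nonneg fun k => hv k a).1 (h ▸ hw a)
      simp [h, congrFun this k]
    · field_simp
  have hle : ∀ k, homEntropy (v k) ≤
      ∑ a, v k a * (Real.log (∑ b, w b) - Real.log (w a)) := by
    intro k
    have h := mul_le (p := w) (K := fun a => v k a / w a) hw0
      fun a => div_nonneg (hv k a) (hw0 a)
    simp_rw [← hvw] at h
    refine h.trans (sub_le_self _ ?_)
    exact mul_nonneg (one_div_nonneg.2 (mul_nonneg (by norm_num)
      (Finset.sum_nonneg fun a _ => hw0 a))) (Finset.sum_nonneg fun a _ =>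
        Finset.sum_nonneg fun b _ => mul_nonneg (mul_nonneg (hw0 a) (hw0 b)) (sq_nonneg _))
  have hsum : HasSum (fun k => ∑ a, v k a * (Real.log (∑ b, w b) - Real.log (w a)))
      (homEntropy w) := hasSum_sum fun a _ => (hw a).mul_right _
  rw [← hsum.tsum_eq]
  exact (summable_of_sum hv fun a => (hw a).summable).tsum_le_tsum hle hsum.summable

/-- Conditioning on less increases the entropy. -/
theorem tsum_le_tsum_marginal (e : L × R ≃ K) {v : K → A → ℝ} {w : L → A → ℝ}
    (hv : ∀ k a, 0 ≤ v k a) (hs : ∀ a, Summable fun k => v k a)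
    (hw : ∀ l a, HasSum (fun r => v (e (l, r)) a) (w l a)) :
    ∑' k, homEntropy (v k) ≤ ∑' l, homEntropy (w l) := by
  have h1 := (summable_of_sum hv hs).comp_injective e.injective
  have hwl : ∀ a, Summable fun l => w l a := by
    intro a
    have h2 := ((hs a).comp_injective e.injective).prod
    exact h2.congr fun l => (hw l a).tsum_eq
  have hw0 : ∀ l a, 0 ≤ w l a := fun l a => (hw l a).nonneg fun r => hv _ a
  rw [← e.tsum_eq fun k => homEntropy (v k)]
  refine (Summable.tsum_prod h1).le.trans ?_
  exact h1.prod.tsum_le_tsum (fun l => tsum_le (fun r a => hv _ a) (hw l))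
    (summable_of_sum hw0 hwl)

end homEntropy

/-! ### Reduction of a subchannel to two observations -/

namespace DMC

variable {X : Type u} {ℓ : ℕ}

theorem hasSum_prod_prob {ι : Type*} [Fintype ι] (W : DMC X) (x : ι → X) :
    HasSum (fun y : ι → W.Out => ∏ j, W.prob (x j) (y j)) 1 := by
  have e := Fintype.equivFin ι
  rw [← (Equiv.arrowCongr e (Equiv.refl W.Out)).symm.hasSum_iff]
  convert W.hasSum_powProb (fun k => x (e.symm k)) using 1
  funext y
  simp only [Function.comp_apply, powProb]
  rw [← e.prod_comp]
  simp [Equiv.arrowCongr]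

/-- Separating two coordinates of a vector from the others. -/
def pairSplit {Y : Type*} {j₁ j₂ : Fin ℓ} (h : j₁ ≠ j₂) :
    (Y × Y) × ({j : Fin ℓ // j ≠ j₁ ∧ j ≠ j₂} → Y) ≃ (Fin ℓ → Y) where
  toFun z j := if h₁ : j = j₁ then z.1.1 else if h₂ : j = j₂ then z.1.2 else z.2 ⟨j, h₁, h₂⟩
  invFun y := ((y j₁, y j₂), fun j => y j)
  left_inv z := by
    refine Prod.ext (Prod.ext ?_ ?_) ?_
    · simp
    · simp [h.symm]
    · funext j
      simp [j.2.1, j.2.2]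
  right_inv y := by
    funext j
    by_cases h₁ : j = j₁
    · simp [h₁]
    · by_cases h₂ : j = j₂
      · simp [h₂, h.symm]
      · simp [h₁, h₂]

theorem powProb_pairSplit (W : DMC X) {j₁ j₂ : Fin ℓ} (h : j₁ ≠ j₂) (x : Fin ℓ → X)
    (y : W.Out × W.Out) (r : {j : Fin ℓ // j ≠ j₁ ∧ j ≠ j₂} → W.Out) :
    W.powProb x (pairSplit h (y, r)) = W.prob (x j₁) y.1 * W.prob (x j₂) y.2 *
      ∏ j : {j : Fin ℓ // j ≠ j₁ ∧ j ≠ j₂}, W.prob (x j) (r j) := by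
  classical
  unfold powProb
  rw [← Finset.mul_prod_erase Finset.univ _ (Finset.mem_univ j₁),
    ← Finset.mul_prod_erase (Finset.univ.erase j₁) _
      (Finset.mem_erase.2 ⟨h.symm, Finset.mem_univ j₂⟩), ← mul_assoc]
  congr 1
  · simp [pairSplit, h.symm]
  · rw [Finset.prod_subtype (p := fun j => j ≠ j₁ ∧ j ≠ j₂) _
      (fun j => by simp [and_comm])]
    refine Finset.prod_congr rfl fun j _ => ?_
    simp [pairSplit, j.2.1, j.2.2]

theorem hasSum_powProb_pairSplit (W : DMC X) {j₁ j₂ : Fin ℓ} (h : j₁ ≠ j₂) (x : Fin ℓ → X)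
    (y : W.Out × W.Out) : HasSum (fun r => W.powProb x (pairSplit h (y, r)))
      (W.prob (x j₁) y.1 * W.prob (x j₂) y.2) := by
  simp_rw [powProb_pairSplit]
  simpa using (W.hasSum_prod_prob fun j : {j : Fin ℓ // j ≠ j₁ ∧ j ≠ j₂} => x j).mul_left
    (W.prob (x j₁) y.1 * W.prob (x j₂) y.2)

/-- The number of inputs with prescribed coordinates up to `i`. -/
theorem card_prescribed [Fintype X] [DecidableEq X] (i : Fin ℓ)
    (p : {j : Fin ℓ // j < i} → X) (a : X) :
    (Finset.univ.filter fun u : Fin ℓ → X => u i = a ∧ ∀ j : {j : Fin ℓ // j < i}, u j = p j).card =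
      ∏ j : Fin ℓ, if j ≤ i then 1 else Fintype.card X := by
  have : (Finset.univ.filter fun u : Fin ℓ → X =>
      u i = a ∧ ∀ j : {j : Fin ℓ // j < i}, u j = p j) = Fintype.piFinset fun j =>
      if h : j < i then {p ⟨j, h⟩} else if j = i then {a} else Finset.univ := by
    ext u
    simp only [Finset.mem_filter, Finset.mem_univ, true_and, Fintype.mem_piFinset]
    refine ⟨fun h j => ?_, fun h => ⟨?_, fun j => ?_⟩⟩
    · by_cases h1 : j < i
      · simpa [h1] using h.2 ⟨j, h1⟩
      · by_cases h2 : j = i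
        · subst h2; simpa using h.1
        · simp [h1, h2]
    · simpa using h i
    · simpa [j.2] using h j
  rw [this, Fintype.card_piFinset]
  refine Finset.prod_congr rfl fun j _ => ?_
  rcases lt_trichotomy j i with h | h | h
  · simp [h, h.le]
  · simp [h]
  · simp [h.not_gt, h.not_ge, h.ne']

variable [Field X] [Fintype X]

/-- The equivocation of the pair of channels `x ↦ W(· ∣ x)` and `x ↦ W(· ∣ b x + s)`. -/
noncomputable def pairEquivocation (W : DMC X) (b s : X) : ℝ :=
  ∑' y : W.Out × W.Out, homEntropy fun x => W.prob x y.1 * W.prob (b * x + s) y.2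

variable [DecidableEq X]

/-- Discarding all outputs but those at `j₁`, `j₂` can only raise the entropy. Given the prefix, the
two channel inputs are `C₁ + a G i j₁` and `C₂ + a G i j₂`, as later inputs do not enter. In the
variable `x = C₁ + a G i j₁` the second one is `b x + s` with `s = C₂ - b C₁`. The product counts
the free inputs after `i`. -/
theorem tsum_homEntropy_prefixSum_le (W : DMC X) {G : Matrix (Fin ℓ) (Fin ℓ) X}
    {i j₁ j₂ : Fin ℓ} (hj : j₁ ≠ j₂) (h₁ : G i j₁ ≠ 0)
    (hlow : ∀ k, i < k → G k j₁ = 0 ∧ G k j₂ = 0) (p : {j : Fin ℓ // j < i} → X)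
    (u₀ : Fin ℓ → X) (hu₀ : ∀ j : {j : Fin ℓ // j < i}, u₀ j = p j) :
    ∑' y : Fin ℓ → W.Out, homEntropy (W.prefixSum (linearKernel G) i p y) ≤
      (∏ j : Fin ℓ, if j ≤ i then 1 else (Fintype.card X : ℝ)) *
        W.pairEquivocation (G i j₂ / G i j₁)
          (u₀ ⬝ᵥ fun k => G k j₂ - G i j₂ / G i j₁ * G k j₁) := by
  set b := G i j₂ / G i j₁ with hb
  have hb1 : b * G i j₁ = G i j₂ := by rw [hb]; field_simp
  set u₁ : Fin ℓ → X := Function.update u₀ i 0 with hu₁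
  have hvec : ∀ (j : Fin ℓ), (∀ k, i < k → G k j = 0) → ∀ a u,
      (u i = a ∧ ∀ k : {j : Fin ℓ // j < i}, u k = p k) →
      linearKernel G u j = u₁ ⬝ᵥ (fun k => G k j) + a * G i j := by
    rintro j hGj a u ⟨hua, hup⟩
    unfold linearKernel Matrix.vecMul dotProduct
    rw [← Finset.add_sum_erase Finset.univ _ (Finset.mem_univ i),
      ← Finset.add_sum_erase Finset.univ (fun k => u₁ k * G k j) (Finset.mem_univ i), hua]
    have : ∀ k ∈ Finset.univ.erase i, u k * G k j = u₁ k * G k j := by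
      intro k hk
      have hki := Finset.ne_of_mem_erase hk
      rcases lt_or_gt_of_ne hki with h | h
      · rw [hu₁, Function.update_of_ne hki, hu₀ ⟨k, h⟩, hup ⟨k, h⟩]
      · rw [hGj k h, mul_zero, mul_zero]
    rw [Finset.sum_congr rfl this]
    simp [hu₁, add_comm]
  -- The coefficient at `i` is zero by the choice of `b`, so resetting that coordinate does not
  -- change `s`.
  have hs : u₁ ⬝ᵥ (fun k => G k j₂) - b * (u₁ ⬝ᵥ fun k => G k j₁) =
      u₀ ⬝ᵥ fun k => G k j₂ - b * G k j₁ := by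
    unfold dotProduct
    rw [Finset.mul_sum, ← Finset.sum_sub_distrib]
    refine Finset.sum_congr rfl fun k _ => ?_
    rcases eq_or_ne k i with rfl | hki
    · simp [hu₁, hb1]
    · rw [hu₁, Function.update_of_ne hki]
      ring
  set C₁ := u₁ ⬝ᵥ (fun k => G k j₁)
  set C₂ := u₁ ⬝ᵥ (fun k => G k j₂)
  set N : ℝ := ∏ j : Fin ℓ, if j ≤ i then 1 else (Fintype.card X : ℝ) with hN
  have hmarg : ∀ (y : W.Out × W.Out) (a : X),
      HasSum (fun r => W.prefixSum (linearKernel G) i p (pairSplit hj (y, r)) a)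
        (N * (W.prob (C₁ + a * G i j₁) y.1 * W.prob (C₂ + a * G i j₂) y.2)) := by
    intro y a
    have h := hasSum_sum (s := Finset.univ.filter fun u : Fin ℓ → X =>
      u i = a ∧ ∀ j : {j : Fin ℓ // j < i}, u j = p j)
      fun u _ => W.hasSum_powProb_pairSplit hj (linearKernel G u) y
    refine Eq.subst (motive := fun s => HasSum _ s) ?_ h
    rw [Finset.sum_congr rfl (g := fun _ =>
      W.prob (C₁ + a * G i j₁) y.1 * W.prob (C₂ + a * G i j₂) y.2), Finset.sum_const,
      card_prescribed, nsmul_eq_mul]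
    · rw [hN]; push_cast; rfl
    · intro u hu
      have hu' := (Finset.mem_filter.1 hu).2
      rw [hvec j₁ (fun k hk => (hlow k hk).1) a u hu', hvec j₂ (fun k hk => (hlow k hk).2) a u hu']
  have hle := homEntropy.tsum_le_tsum_marginal (pairSplit hj)
    (fun y a => W.prefixSum_nonneg (linearKernel G) i p y a)
    (fun a => summable_sum fun u _ => (W.hasSum_powProb (linearKernel G u)).summable) hmarg
  refine hle.trans (le_of_eq ?_)
  simp_rw [homEntropy.const_mul]
  rw [tsum_mul_left, pairEquivocation, ← hs]
  congr 2
  funext y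
  rw [← homEntropy.comp_equiv ((Equiv.mulRight₀ (G i j₁) h₁).trans (Equiv.addLeft C₁))
    fun x => W.prob x y.1 * W.prob (b * x + (C₂ - b * C₁)) y.2]
  congr 1
  funext a
  have : b * (C₁ + a * G i j₁) + (C₂ - b * C₁) = C₂ + a * G i j₂ := by
    rw [← hb1]; ring
  simp [this]

/-- The subchannel at `i` is at least as good as the channel with two observations. -/
theorem equivocation_subchannel_le (W : DMC X) {G : Matrix (Fin ℓ) (Fin ℓ) X}
    (hG : IsUnit G.det) {i j₁ j₂ : Fin ℓ} (hj : j₁ ≠ j₂) (h₁ : G i j₁ ≠ 0)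
    (hlow : ∀ k, i < k → G k j₁ = 0 ∧ G k j₂ = 0) :
    (W.subchannel (linearKernel G) i).equivocation ≤
      1 / (Fintype.card X : ℝ) * ∑ s, W.pairEquivocation (G i j₂ / G i j₁) s := by
  obtain ⟨k, hk⟩ := exists_sub_mul_ne_zero hG hj (G i j₂ / G i j₁)
  have hq : (0 : ℝ) < Fintype.card X := by exact_mod_cast Fintype.card_pos
  set q : ℝ := (Fintype.card X : ℝ) with hqdef
  set c : Fin ℓ → X := fun k => G k j₂ - G i j₂ / G i j₁ * G k j₁ with hc
  set Φ := W.pairEquivocation (G i j₂ / G i j₁)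
  set N : ℝ := ∏ j : Fin ℓ, if j ≤ i then 1 else q with hN
  have hequi := card_mul_sum_dotProduct (c := c) hk Φ
  -- The sum over prefixes is rewritten over full inputs, each prefix having `q N` extensions, so
  -- that equidistribution of `u ⬝ᵥ c` applies.
  have hsum : ∑ u : Fin ℓ → X, ∑' y : Fin ℓ → W.Out,
      homEntropy (W.prefixSum (linearKernel G) i (fun j => u j) y) =
      q * N * ∑ p : {j : Fin ℓ // j < i} → X, ∑' y : Fin ℓ → W.Out,
        homEntropy (W.prefixSum (linearKernel G) i p y) := by
    rw [← Finset.sum_fiberwise Finset.univ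
        (fun u : Fin ℓ → X => ((fun j : {j : Fin ℓ // j < i} => u j), u i)),
      Fintype.sum_prod_type, Finset.mul_sum]
    refine Finset.sum_congr rfl fun p _ => ?_
    have : ∀ a : X, ∑ u : Fin ℓ → X with ((fun j : {j : Fin ℓ // j < i} => u j), u i) = (p, a),
        ∑' y : Fin ℓ → W.Out, homEntropy (W.prefixSum (linearKernel G) i (fun j => u j) y) =
        N * ∑' y : Fin ℓ → W.Out, homEntropy (W.prefixSum (linearKernel G) i p y) := by
      intro a
      rw [Finset.sum_congr rfl (g := fun _ =>
        ∑' y : Fin ℓ → W.Out, homEntropy (W.prefixSum (linearKernel G) i p y)), Finset.sum_const,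
        nsmul_eq_mul]
      · congr 1
        rw [hN, hqdef]
        have h := card_prescribed i p a
        have h' : (Finset.univ.filter fun u : Fin ℓ → X =>
            ((fun j : {j : Fin ℓ // j < i} => u j), u i) = (p, a)) = Finset.univ.filter
            fun u : Fin ℓ → X => u i = a ∧ ∀ j : {j : Fin ℓ // j < i}, u j = p j := by
          ext u
          simp only [Finset.mem_filter, Finset.mem_univ, true_and, Prod.ext_iff, funext_iff]
          exact and_comm
        rw [h', h]
        push_cast
        rfl
      · intro u hu
        have hup := (Prod.mk.inj (Finset.mem_filter.1 hu).2).1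
        rw [hup]
    rw [Finset.sum_congr rfl fun a _ => this a]
    simp only [Finset.sum_const, Finset.card_univ, nsmul_eq_mul, ← hqdef]
    ring
  have hle : ∑ u : Fin ℓ → X, ∑' y : Fin ℓ → W.Out,
      homEntropy (W.prefixSum (linearKernel G) i (fun j => u j) y) ≤
      ∑ u : Fin ℓ → X, N * Φ (u ⬝ᵥ c) :=
    Finset.sum_le_sum fun u _ => W.tsum_homEntropy_prefixSum_le hj h₁ hlow _ u fun _ => rfl
  have hNpos : 0 < N := Finset.prod_pos fun j _ => by split_ifs <;> positivity
  rw [hsum, ← Finset.mul_sum] at hle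
  rw [equivocation_subchannel]
  set P := ∑ p : {j : Fin ℓ // j < i} → X, ∑' y : Fin ℓ → W.Out,
        homEntropy (W.prefixSum (linearKernel G) i p y)
  have hℓ : q ^ ℓ = q ^ (ℓ - 1) * q := by
    rw [← pow_succ, Nat.sub_add_cancel (Nat.one_le_of_lt i.2)]
  have h3 : q * P ≤ ∑ u : Fin ℓ → X, Φ (u ⬝ᵥ c) := by
    refine le_of_mul_le_mul_left ?_ hNpos
    linarith
  rw [one_div, one_div, inv_mul_le_iff₀ (by positivity), inv_mul_eq_div, mul_div_assoc',
    le_div_iff₀ hq]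
  refine le_of_mul_le_mul_left ?_ hq
  rw [hℓ] at hequi
  nlinarith

end DMC

/-! ### The gain from a randomly shifted second observation -/

namespace homEntropy

variable {A : Type*} [Fintype A]

/-- The homogeneous form of the collision gap `1 - ∑ a, p a ^ 2`. -/
noncomputable def collisionGap (p : A → ℝ) : ℝ :=
  1 / (∑ a, p a) * ∑ a, p a * (∑ b, p b - p a)

/-- The sum of all squared differences of the square roots. -/
noncomputable def hellingerSum (p : A → ℝ) : ℝ :=
  ∑ a, ∑ b, (√(p a) - √(p b)) ^ 2

theorem le_sum {p : A → ℝ} (hp : ∀ a, 0 ≤ p a) (a : A) : p a ≤ ∑ b, p b :=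
  Finset.single_le_sum (f := p) (fun b _ => hp b) (Finset.mem_univ a)

theorem collisionGap_nonneg {p : A → ℝ} (hp : ∀ a, 0 ≤ p a) : 0 ≤ collisionGap p :=
  mul_nonneg (one_div_nonneg.2 (Finset.sum_nonneg fun a _ => hp a))
    (Finset.sum_nonneg fun a _ => mul_nonneg (hp a) (sub_nonneg.2 (le_sum hp a)))

theorem collisionGap_le {p : A → ℝ} (hp : ∀ a, 0 ≤ p a) : collisionGap p ≤ ∑ a, p a := by
  have hS : 0 ≤ ∑ a, p a := Finset.sum_nonneg fun a _ => hp a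
  rcases hS.eq_or_lt with h | h
  · simp [collisionGap, ← h]
  · unfold collisionGap
    rw [one_div, inv_mul_le_iff₀ h, Finset.sum_mul]
    exact Finset.sum_le_sum fun a _ => mul_le_mul_of_nonneg_left (by linarith [hp a]) (hp a)

theorem hellingerSum_nonneg (p : A → ℝ) : 0 ≤ hellingerSum p :=
  Finset.sum_nonneg fun _ _ => Finset.sum_nonneg fun _ _ => sq_nonneg _

theorem hellingerSum_le {p : A → ℝ} (hp : ∀ a, 0 ≤ p a) :
    hellingerSum p ≤ 2 * Fintype.card A * ∑ a, p a := by
  have h : hellingerSum p ≤ ∑ a, ∑ b, (p a + p b) := by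
    refine Finset.sum_le_sum fun a _ => Finset.sum_le_sum fun b _ => ?_
    nlinarith [Real.sq_sqrt (hp a), Real.sq_sqrt (hp b),
      mul_nonneg (Real.sqrt_nonneg (p a)) (Real.sqrt_nonneg (p b))]
  refine h.trans (le_of_eq ?_)
  simp only [Finset.sum_add_distrib, Finset.sum_const, Finset.card_univ, nsmul_eq_mul,
    ← Finset.mul_sum]
  ring

/-- The gain in the entropy from a second observation through randomly shifted weights. -/
theorem sum_shift_le {X : Type u} [Field X] [Fintype X] (hq : (Fintype.card X).Prime) {b : X}
    (hb : b ≠ 0) {p r : X → ℝ} (hp : ∀ x, 0 ≤ p x) (hr : ∀ x, 0 ≤ r x) :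
    ∑ s, homEntropy (fun x => p x * r (b * x + s)) ≤ homEntropy p * ∑ z, r z -
      1 / (4 * (Fintype.card X : ℝ) ^ 4) * (collisionGap p * hellingerSum r) := by
  classical
  have hq0 : (0 : ℝ) < Fintype.card X := by exact_mod_cast hq.pos
  set q : ℝ := (Fintype.card X : ℝ) with hqdef
  set S := ∑ x, p x with hS
  have hS0 : 0 ≤ S := Finset.sum_nonneg fun x _ => hp x
  -- Summing over `s` leaves the squared differences of `√r` along the shift `b (x' - x) ≠ 0`. Each
  -- of the `q²` pairs in the Hellinger sum costs a factor `q²`, hence `q⁴`.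
  have hshift : ∀ x x', x ≠ x' → hellingerSum r / q ^ 4 ≤
      ∑ s, (√(r (b * x + s)) - √(r (b * x' + s))) ^ 2 := by
    intro x x' hx
    have hd : b * (x' - x) ≠ 0 := mul_ne_zero hb (sub_ne_zero.2 hx.symm)
    have e : ∑ s, (√(r (b * x + s)) - √(r (b * x' + s))) ^ 2 =
        ∑ z, (√(r z) - √(r (z + b * (x' - x)))) ^ 2 := by
      rw [← Equiv.sum_comp (Equiv.addLeft (b * x))
        fun z => (√(r z) - √(r (z + b * (x' - x)))) ^ 2]
      refine Finset.sum_congr rfl fun s _ => ?_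
      rw [Equiv.coe_addLeft]
      congr 4
      ring_nf
    rw [e, div_le_iff₀ (by positivity)]
    have h1 : hellingerSum r ≤ ∑ _a : X, ∑ _b : X,
        (q ^ 2 * ∑ z, (√(r z) - √(r (z + b * (x' - x)))) ^ 2) :=
      Finset.sum_le_sum fun a _ => Finset.sum_le_sum fun c _ =>
        sq_sub_le_of_prime_card hq hd (fun z => √(r z)) a c
    refine h1.trans (le_of_eq ?_)
    simp only [Finset.sum_const, Finset.card_univ, nsmul_eq_mul, ← hqdef]
    ring
  -- Off-diagonal pairs have total weight `∑ p x (S - p x)`, which is `S` times the collision gap.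
  have hpair : 1 / (4 * q ^ 4) * (collisionGap p * hellingerSum r) ≤
      ∑ s, 1 / (4 * S) * ∑ x, ∑ x', p x * p x' * (√(r (b * x + s)) - √(r (b * x' + s))) ^ 2 := by
    rw [← Finset.mul_sum, Finset.sum_comm]
    have e : 1 / (4 * q ^ 4) * (collisionGap p * hellingerSum r) =
        1 / (4 * S) * ((∑ x, p x * (S - p x)) * (hellingerSum r / q ^ 4)) := by
      unfold collisionGap
      rw [← hS]
      field_simp
    rw [e]
    refine mul_le_mul_of_nonneg_left ?_ (by positivity)
    rw [Finset.sum_mul]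
    refine Finset.sum_le_sum fun x _ => ?_
    rw [Finset.sum_comm, ← Finset.add_sum_erase _ _ (Finset.mem_univ x)]
    have hx : S - p x = ∑ x' ∈ Finset.univ.erase x, p x' := by
      rw [hS, ← Finset.add_sum_erase _ _ (Finset.mem_univ x)]; ring
    rw [hx, Finset.mul_sum, Finset.sum_mul]
    refine le_add_of_nonneg_of_le (Finset.sum_nonneg fun s _ =>
      mul_nonneg (mul_nonneg (hp x) (hp x)) (sq_nonneg _)) (Finset.sum_le_sum fun x' hx' => ?_)
    rw [← Finset.mul_sum]
    exact mul_le_mul_of_nonneg_left (hshift x x' (Finset.ne_of_mem_erase hx').symm)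
      (mul_nonneg (hp x) (hp x'))
  have hmain := Finset.sum_le_sum fun s (_ : s ∈ (Finset.univ : Finset X)) =>
    mul_le hp (K := fun x => r (b * x + s)) fun x => hr _
  rw [Finset.sum_sub_distrib] at hmain
  -- For fixed `x`, summing over `s` runs through all values of `r`, so the main term factorizes.
  have hfirst : ∑ s, ∑ x, p x * r (b * x + s) * (Real.log S - Real.log (p x)) =
      homEntropy p * ∑ z, r z := by
    rw [Finset.sum_comm]
    unfold homEntropy
    rw [← hS, Finset.sum_mul]
    refine Finset.sum_congr rfl fun x _ => ?_
    rw [← Equiv.sum_comp (Equiv.addLeft (b * x)) r, Finset.mul_sum]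
    refine Finset.sum_congr rfl fun s _ => ?_
    rw [Equiv.coe_addLeft]
    ring
  rw [hfirst] at hmain
  linarith

end homEntropy

/-! ### The capacity gain of a nontrivial kernel -/

namespace DMC

variable {X : Type u} [Fintype X]

theorem summable_collisionGap (W : DMC X) :
    Summable fun y => homEntropy.collisionGap fun x => W.prob x y :=
  Summable.of_nonneg_of_le (fun y => homEntropy.collisionGap_nonneg fun x => W.prob_nonneg x y)
    (fun y => homEntropy.collisionGap_le fun x => W.prob_nonneg x y) W.hasSum_sum_prob.summable

theorem summable_hellingerSum (W : DMC X) :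
    Summable fun y => homEntropy.hellingerSum fun x => W.prob x y :=
  Summable.of_nonneg_of_le (fun _ => homEntropy.hellingerSum_nonneg _)
    (fun y => homEntropy.hellingerSum_le fun x => W.prob_nonneg x y)
    (W.hasSum_sum_prob.summable.mul_left _)

theorem card_mul_log_sub_equivocation_le (W : DMC X) :
    Fintype.card X * Real.log (Fintype.card X) - W.equivocation ≤
      ∑' y, homEntropy.hellingerSum fun x => W.prob x y := by
  have h1 := W.hasSum_sum_prob.mul_right (Real.log (Fintype.card X))
  rw [← h1.tsum_eq, equivocation, ← h1.summable.tsum_sub W.summable_homEntropy]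
  exact (h1.summable.sub W.summable_homEntropy).tsum_le_tsum
    (fun y => homEntropy.card_sub_le fun x => W.prob_nonneg x y) W.summable_hellingerSum

theorem equivocation_sq_le (W : DMC X) : W.equivocation ^ 2 ≤ 4 * (Fintype.card X : ℝ) ^ 2 *
    ∑' y, homEntropy.collisionGap fun x => W.prob x y := by
  set C := ∑' y, homEntropy.collisionGap fun x => W.prob x y with hC
  have hC0 : 0 ≤ C := tsum_nonneg fun y =>
    homEntropy.collisionGap_nonneg fun x => W.prob_nonneg x y
  rcases W.equivocation_nonneg.eq_or_lt with h | h
  · rw [← h]; exact le_of_eq_of_le (zero_pow two_ne_zero) (by positivity)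
  have hq : (0 : ℝ) < Fintype.card X := by
    rcases isEmpty_or_nonempty X with hX | hX
    · simp [equivocation, homEntropy] at h
    · exact_mod_cast Fintype.card_pos
  set q : ℝ := (Fintype.card X : ℝ) with hqdef
  set E := W.equivocation with hE
  -- Summing `le_collision` over outputs gives `E ≤ q² t + C / t`; this `t` makes the first term `E
  -- / 2`, which moves to the left side.
  have ht : 0 < E / (2 * q ^ 2) := by positivity
  set t := E / (2 * q ^ 2) with htdef
  have h1 := (W.hasSum_sum_prob.mul_left (q * t)).add
    (W.summable_collisionGap.hasSum.mul_left (1 / t))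
  have h2 : E ≤ q * t * q + 1 / t * C := by
    rw [hE, equivocation, ← h1.tsum_eq]
    exact W.summable_homEntropy.tsum_le_tsum
      (fun y => homEntropy.le_collision (fun x => W.prob_nonneg x y) ht) h1.summable
  have h3 : q * t * q = E / 2 := by rw [htdef]; field_simp
  have h4 : 1 / t * C = 2 * q ^ 2 * C / E := by rw [htdef]; field_simp
  rw [h3, h4] at h2
  have h5 : E / 2 ≤ 2 * q ^ 2 * C / E := by linarith
  rw [le_div_iff₀ h] at h5
  nlinarith

variable [Field X]

theorem summable_pairEquivocation (W : DMC X) (b s : X) : Summable fun y : W.Out × W.Out =>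
    homEntropy fun x => W.prob x y.1 * W.prob (b * x + s) y.2 :=
  homEntropy.summable_of_sum (fun _ _ => mul_nonneg (W.prob_nonneg _ _) (W.prob_nonneg _ _))
    fun x => (W.hasSum_prob x).summable.mul_of_nonneg (W.hasSum_prob (b * x + s)).summable
      (W.prob_nonneg _) (W.prob_nonneg _)

/-- In `sum_shift_le` the gain at `(y₁, y₂)` is a function of `y₁` times a function of `y₂`, so its
double series is a product. -/
theorem sum_pairEquivocation_le (hq : (Fintype.card X).Prime) {b : X} (hb : b ≠ 0) (W : DMC X) :
    ∑ s, W.pairEquivocation b s ≤ Fintype.card X * W.equivocation -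
      1 / (4 * (Fintype.card X : ℝ) ^ 4) *
        ((∑' y, homEntropy.collisionGap fun x => W.prob x y) *
          ∑' y, homEntropy.hellingerSum fun x => W.prob x y) := by
  have n2 : ∀ y, 0 ≤ ∑ x, W.prob x y := fun y => Finset.sum_nonneg fun x _ => W.prob_nonneg x y
  have n3 : ∀ y, 0 ≤ homEntropy.collisionGap fun x => W.prob x y := fun y =>
    homEntropy.collisionGap_nonneg fun x => W.prob_nonneg x y
  have n4 : ∀ y, 0 ≤ homEntropy.hellingerSum fun x => W.prob x y := fun _ =>
    homEntropy.hellingerSum_nonneg _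
  have s1 := W.summable_homEntropy.mul_of_nonneg W.hasSum_sum_prob.summable
    W.homEntropy_prob_nonneg n2
  have s2 := W.summable_collisionGap.mul_of_nonneg W.summable_hellingerSum n3 n4
  have h1 := W.summable_homEntropy.hasSum.mul W.hasSum_sum_prob s1
  have h2 := W.summable_collisionGap.hasSum.mul W.summable_hellingerSum.hasSum s2
  have h3 := h1.sub (h2.mul_left (1 / (4 * (Fintype.card X : ℝ) ^ 4)))
  rw [mul_comm (Fintype.card X : ℝ) W.equivocation]
  unfold equivocation
  rw [← h3.tsum_eq]
  unfold pairEquivocation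
  rw [← Summable.tsum_finsetSum fun s _ => W.summable_pairEquivocation b s]
  exact (summable_sum fun s _ => W.summable_pairEquivocation b s).tsum_le_tsum
    (fun z => homEntropy.sum_shift_le hq hb (fun x => W.prob_nonneg x z.1)
      fun x => W.prob_nonneg x z.2) h3.summable

/-- For a kernel that is not trivial some subchannel is strictly better than `W`, with a gain that
depends only on the symmetric capacity of `W`. -/
theorem exists_symCapacity_gain [DecidableEq X] (hq : (Fintype.card X).Prime) {ℓ : ℕ}
    {G : Matrix (Fin ℓ) (Fin ℓ) X} (hG : IsUnit G.det) (hG' : ¬ IsTrivialKernel G) :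
    ∃ (i : Fin ℓ) (c : ℝ), 0 < c ∧ ∀ W : DMC X,
      c * (W.symCapacity * (1 - W.symCapacity) ^ 2) ≤
        (W.subchannel (linearKernel G) i).symCapacity - W.symCapacity := by
  obtain ⟨i, j₁, j₂, hj, h₁, h₂, hlow⟩ := exists_row_of_not_isTrivialKernel hG hG'
  have hq1 : (1 : ℝ) < Fintype.card X := by exact_mod_cast hq.one_lt
  have hlog := Real.log_pos hq1
  -- With `L = q log q` one has `E = L (1 - I)` and `L - E = L I`. The drop in equivocation is at
  -- least `E² (L - E) / (16 q⁷)`; division by `L` yields this constant.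
  refine ⟨i, (Fintype.card X * Real.log (Fintype.card X)) ^ 2 / (16 * (Fintype.card X : ℝ) ^ 7),
    by positivity, fun W => ?_⟩
  have e1 := W.equivocation_subchannel_le hG hj h₁ hlow
  have e2 := W.sum_pairEquivocation_le hq (div_ne_zero h₂ h₁)
  have e3 := W.card_mul_log_sub_equivocation_le
  have e4 := W.equivocation_sq_le
  have e5 := W.equivocation_le
  rw [symCapacity_eq hq.one_lt, symCapacity_eq hq.one_lt]
  set q : ℝ := (Fintype.card X : ℝ) with hqdef
  have hq0 : 0 < q := by linarith
  have hL : 0 < q * Real.log q := by positivity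
  set L := q * Real.log q
  set E := W.equivocation
  set E' := (W.subchannel (linearKernel G) i).equivocation
  set C := ∑' y, homEntropy.collisionGap fun x => W.prob x y
  set M := ∑' y, homEntropy.hellingerSum fun x => W.prob x y
  have hCM : E ^ 2 / (4 * q ^ 2) * (L - E) ≤ C * M := by
    have : E ^ 2 / (4 * q ^ 2) ≤ C := by
      rw [div_le_iff₀ (by positivity)]; linarith
    exact mul_le_mul this e3 (by linarith) (le_trans (by positivity) this)
  have h6 : E' ≤ E - 1 / (4 * q ^ 5) * (C * M) := by
    refine e1.trans ?_
    rw [one_div, inv_mul_le_iff₀ hq0]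
    refine e2.trans (le_of_eq ?_)
    field_simp
  have h7 : 1 / (4 * q ^ 5) * (E ^ 2 / (4 * q ^ 2) * (L - E)) ≤ E - E' := by
    have := mul_le_mul_of_nonneg_left hCM (show 0 ≤ 1 / (4 * q ^ 5) by positivity)
    linarith
  have h8 : 1 - E' / L - (1 - E / L) = (E - E') / L := by ring
  have h9 : L ^ 2 / (16 * q ^ 7) * ((1 - E / L) * (1 - (1 - E / L)) ^ 2) =
      1 / (4 * q ^ 5) * (E ^ 2 / (4 * q ^ 2) * (L - E)) / L := by
    field_simp
    ring
  rw [h8, h9]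
  exact div_le_div_of_nonneg_right h7 hL.le

end DMC

/-! ### Independent uniform indices and their filtration -/

/-- The filtration whose `n`-th stage is generated by the variables with index less than `n`. -/
def pastFiltration {Ω β : Type*} [MeasurableSpace Ω] [MeasurableSpace β] {B : ℕ → Ω → β}
    (hB : ∀ n, Measurable (B n)) : Filtration ℕ ‹MeasurableSpace Ω› where
  seq n := ⨆ k ∈ Set.Iio n, MeasurableSpace.comap (B k) inferInstance
  mono' _ _ h := biSup_mono fun _ hk => lt_of_lt_of_le hk h
  le' _ := iSup₂_le fun k _ => (hB k).comap_le

section PastFiltration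

variable {Ω β : Type*} [MeasurableSpace Ω] [MeasurableSpace β] {B : ℕ → Ω → β}
  (hB : ∀ n, Measurable (B n))

theorem measurable_pastFiltration_succ (n : ℕ) : Measurable[pastFiltration hB (n + 1)] (B n) := by
  have h : MeasurableSpace.comap (B n) inferInstance ≤ pastFiltration hB (n + 1) :=
    le_biSup (fun k => MeasurableSpace.comap (B k) inferInstance) (Set.mem_Iio.2 n.lt_succ_self)
  exact measurable_iff_comap_le.2 h

theorem indep_comap_pastFiltration {P : Measure Ω} (hi : iIndepFun B P) (n : ℕ) :
    Indep (MeasurableSpace.comap (B n) inferInstance) (pastFiltration hB n) P := by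
  have h := indep_iSup_of_disjoint (fun k => (hB k).comap_le) hi
    (S := {n}) (T := Set.Iio n) (by simp)
  rw [iSup_singleton] at h
  exact h

/-- A fresh uniform index averages a family of functions of the past. -/
theorem condExp_apply_uniform {ℓ : ℕ} {P : Measure Ω} [IsProbabilityMeasure P]
    {B : ℕ → Ω → Fin ℓ} (hB : ∀ n, Measurable (B n)) (hi : iIndepFun B P)
    (hu : ∀ n k, P {ω | B n ω = k} = 1 / (ℓ : ENNReal)) (n : ℕ) {f : Fin ℓ → Ω → ℝ}
    (hf : ∀ k, StronglyMeasurable[pastFiltration hB n] (f k)) {C : ℝ}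
    (hC : ∀ k ω, |f k ω| ≤ C) :
    P[fun ω => f (B n ω) ω | pastFiltration hB n] =ᵐ[P] fun ω => (∑ k, f k ω) / ℓ := by
  have hle := (pastFiltration hB).le n
  set g : Fin ℓ → Ω → ℝ := fun k => (B n ⁻¹' {k}).indicator 1 with hg
  have hms : ∀ k, MeasurableSet (B n ⁻¹' {k}) := fun k => hB n (measurableSet_singleton k)
  have hfint : ∀ k, Integrable (f k) P := fun k =>
    Integrable.of_bound ((hf k).mono hle).aestronglyMeasurable C (ae_of_all _ (hC k))
  have hgint : ∀ k, Integrable (g k) P := fun k => (integrable_const 1).indicator (hms k)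
  have hfg : ∀ k, f k * g k = (B n ⁻¹' {k}).indicator (f k) := by
    intro k
    funext ω
    by_cases h : ω ∈ B n ⁻¹' {k}
    · simp [hg, Set.indicator_of_mem h]
    · simp [hg, Set.indicator_of_notMem h]
  have hfgint : ∀ k, Integrable (f k * g k) P := fun k => by
    rw [hfg]; exact (hfint k).indicator (hms k)
  -- Splitting by the value of `B n` leaves factors `f k` known from the past times indicators
  -- independent of it, each of mean `1 / ℓ`.
  have hsum : (fun ω => f (B n ω) ω) = ∑ k, f k * g k := by
    funext ω
    rw [Finset.sum_apply, Finset.sum_eq_single (B n ω)]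
    · simp [hg]
    · intro k _ hk
      simp [hg, Set.indicator_of_notMem (show ω ∉ B n ⁻¹' {k} from fun h => hk h.symm)]
    · simp
  have hcond : ∀ k, P[g k | pastFiltration hB n] =ᵐ[P] fun _ => 1 / (ℓ : ℝ) := by
    intro k
    have hgm : StronglyMeasurable[MeasurableSpace.comap (B n) inferInstance] (g k) :=
      stronglyMeasurable_one.indicator ⟨{k}, measurableSet_singleton k, rfl⟩
    have h := condExp_indep_eq (hB n).comap_le hle hgm (indep_comap_pastFiltration hB hi n)
    refine h.trans (ae_of_all _ fun ω => ?_)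
    have e : P.real (B n ⁻¹' {k}) = 1 / (ℓ : ℝ) := by
      have := hu n k
      rw [Measure.real, show B n ⁻¹' {k} = {ω | B n ω = k} from rfl, this]
      simp
    simp only [hg]
    rw [integral_indicator_one (hms k), e]
  have hk : ∀ k, P[f k * g k | pastFiltration hB n] =ᵐ[P] fun ω => f k ω * (1 / (ℓ : ℝ)) := by
    intro k
    refine (condExp_mul_of_stronglyMeasurable_left (hf k) (hfgint k) (hgint k)).trans ?_
    filter_upwards [hcond k] with ω hω
    rw [Pi.mul_apply, hω]
  rw [hsum]
  refine (condExp_finsetSum (fun k _ => hfgint k) _).trans ?_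
  filter_upwards [ae_all_iff.2 hk] with ω hω
  rw [Finset.sum_apply, Finset.sum_congr rfl fun k _ => hω k, ← Finset.sum_mul]
  ring

/-- Independent uniform variables take each value infinitely often. -/
theorem ae_frequently_eq_of_uniform {ℓ : ℕ} {P : Measure Ω} [IsProbabilityMeasure P]
    {B : ℕ → Ω → Fin ℓ} (hB : ∀ n, Measurable (B n)) (hi : iIndepFun B P)
    (hu : ∀ n k, P {ω | B n ω = k} = 1 / (ℓ : ENNReal)) (k : Fin ℓ) :
    ∀ᵐ ω ∂P, ∃ᶠ n in atTop, B n ω = k := by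
  have hms : ∀ n, MeasurableSet (B n ⁻¹' {k}) := fun n => hB n (measurableSet_singleton k)
  have hind : iIndepSet (fun n => B n ⁻¹' {k}) P := by
    rw [iIndepSet_iff_meas_biInter hms]
    intro S
    exact (iIndepFun_iff_measure_inter_preimage_eq_mul.1 hi) S
      (sets := fun _ => {k}) fun _ _ => measurableSet_singleton k
  have hsum : ∑' n, P (B n ⁻¹' {k}) = ⊤ := by
    have : ∀ n, P (B n ⁻¹' {k}) = 1 / (ℓ : ENNReal) := fun n => hu n k
    simp_rw [this]
    refine ENNReal.tsum_const_eq_top_of_ne_zero ?_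
    simp
  have h := measure_limsup_eq_one hms hind hsum
  have hlm : MeasurableSet (limsup (fun n => B n ⁻¹' {k}) atTop) :=
    MeasurableSet.measurableSet_limsup hms
  have h' := (prob_compl_eq_zero_iff hlm).2 h
  rw [← mem_ae_iff] at h'
  filter_upwards [h'] with ω hω
  exact mem_limsup_iff_frequently_mem (s := fun n => B n ⁻¹' {k}).1 hω

end PastFiltration

namespace DMC

variable {X : Type u} [Fintype X] [DecidableEq X] {ℓ : ℕ} {Ω : Type*} [MeasurableSpace Ω]

/-- Every function of the `n`-th random subchannel is measurable with respect to the first `n`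
indices. -/
theorem measurable_iterSubchannel (g : (Fin ℓ → X) → (Fin ℓ → X)) (W : DMC X) {B : ℕ → Ω → Fin ℓ}
    (hB : ∀ n, Measurable (B n)) (n : ℕ) (Φ : DMC X → ℝ) :
    Measurable[pastFiltration hB n] fun ω => Φ (W.iterSubchannel g (fun m => B m ω) n) := by
  -- There is no σ-algebra on channels, so the induction treats all functionals at once: `Φ` of the
  -- next channel evaluates the finite family `V ↦ Φ (V.subchannel g k)` at `k = B n`.
  induction n generalizing Φ with
  | zero => exact measurable_const (a := Φ W)
  | succ n ih =>
    have hle : pastFiltration hB n ≤ pastFiltration hB (n + 1) :=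
      (pastFiltration hB).mono n.le_succ
    have hpair : Measurable[pastFiltration hB (n + 1)] fun ω => (B n ω, fun k : Fin ℓ =>
        Φ ((W.iterSubchannel g (fun m => B m ω) n).subchannel g k)) :=
      Measurable.prodMk (measurable_pastFiltration_succ hB n)
        ((@measurable_pi_iff _ _ _ (pastFiltration hB (n + 1)) _ _).2 fun k =>
        (ih fun V => Φ (V.subchannel g k)).mono hle le_rfl)
    have heval : Measurable fun z : Fin ℓ × (Fin ℓ → ℝ) => z.2 z.1 :=
      measurable_from_prod_countable_right fun k => measurable_pi_apply k
    exact heval.comp hpair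

end DMC

/-! ### Martingale convergence and polarization -/

theorem mainTheorem1 {X : Type u} [Field X] [Fintype X] [DecidableEq X]
    (hq : (Fintype.card X).Prime)
    {ℓ : ℕ} (G : Matrix (Fin ℓ) (Fin ℓ) X) (hG : IsUnit G.det) (hG' : ¬ IsTrivialKernel G)
    (W : DMC X)
    {Ω : Type*} [MeasurableSpace Ω] (P : Measure Ω) [IsProbabilityMeasure P]
    (B : ℕ → Ω → Fin ℓ) (hBm : ∀ n, Measurable (B n)) (hBi : iIndepFun B P)
    (hBu : ∀ n k, P {ω | B n ω = k} = 1 / (ℓ : ENNReal)) :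
    ∃ Iinf : Ω → ℝ, Measurable Iinf ∧
      (∀ᵐ ω ∂P, Tendsto
        (fun n => (W.iterSubchannel (linearKernel G) (fun m => B m ω) n).symCapacity)
        atTop (𝓝 (Iinf ω))) ∧
      P {ω | Iinf ω = 0 ∨ Iinf ω = 1} = 1 := by
  obtain ⟨i, c, hc, hgain⟩ := DMC.exists_symCapacity_gain hq hG hG'
  have hbij : Function.Bijective (linearKernel G) :=
    Finite.injective_iff_bijective.1
      (Matrix.vecMul_injective_of_isUnit ((Matrix.isUnit_iff_isUnit_det G).2 hG))
  have hℓ : (ℓ : ℝ) ≠ 0 := by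
    have := i.pos
    exact_mod_cast this.ne'
  set V : ℕ → Ω → DMC X := fun n ω => W.iterSubchannel (linearKernel G) (fun m => B m ω) n
  set J : ℕ → Ω → ℝ := fun n ω => (V n ω).symCapacity with hJ
  have hmem : ∀ n ω, J n ω ∈ Set.Icc (0 : ℝ) 1 := fun n ω =>
    DMC.symCapacity_mem_Icc hq.one_lt _
  have habs : ∀ U : DMC X, |U.symCapacity| ≤ 1 := fun U => by
    have := U.symCapacity_mem_Icc hq.one_lt
    exact abs_le.2 ⟨by linarith [this.1], this.2⟩
  have hmeas : ∀ n, StronglyMeasurable[pastFiltration hBm n] (J n) := fun n =>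
    (W.measurable_iterSubchannel (linearKernel G) hBm n DMC.symCapacity).stronglyMeasurable
  have hint : ∀ n, Integrable (J n) P := fun n =>
    Integrable.of_bound ((hmeas n).mono ((pastFiltration hBm).le n)).aestronglyMeasurable 1
      (ae_of_all _ fun ω => habs _)
  have hmart : Martingale J (pastFiltration hBm) P := by
    refine martingale_nat hmeas hint fun n => ?_
    have h := condExp_apply_uniform hBm hBi hBu n
      (f := fun k ω => ((V n ω).subchannel (linearKernel G) k).symCapacity)
      (fun k => (W.measurable_iterSubchannel (linearKernel G) hBm n fun U =>
        (U.subchannel (linearKernel G) k).symCapacity).stronglyMeasurable) fun k ω => habs _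
    refine EventuallyEq.trans (ae_of_all _ fun ω => ?_) h.symm
    simp only [DMC.sum_symCapacity_subchannel hq.one_lt hbij (V n ω)]
    exact (mul_div_cancel_left₀ _ hℓ).symm
  have hconv := hmart.submartingale.ae_tendsto_limitProcess (R := 1) fun n => by
    refine (eLpNorm_le_of_ae_bound (C := 1) (ae_of_all _ fun ω => habs _)).trans ?_
    simp
  obtain ⟨Iinf, hImeas, hIconv⟩ := measurable_limit_of_tendsto_metrizable_ae
    (fun n => (hint n).aestronglyMeasurable.aemeasurable) (hconv.mono fun ω h => ⟨_, h⟩)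
  refine ⟨Iinf, hImeas, hIconv, ?_⟩
  rw [← measure_univ (μ := P)]
  refine measure_congr (eventuallyEq_univ.2 ?_)
  filter_upwards [hIconv, ae_frequently_eq_of_uniform hBm hBi hBu i] with ω hlim hfreq
  set a := Iinf ω
  have hstep : Tendsto (fun n => J (n + 1) ω - J n ω) atTop (𝓝 (a - a)) :=
    (hlim.comp (tendsto_add_atTop_nat 1)).sub hlim
  have hlow : Tendsto (fun n => c * (J n ω * (1 - J n ω) ^ 2)) atTop
      (𝓝 (c * (a * (1 - a) ^ 2))) :=
    (hlim.mul ((tendsto_const_nhds.sub hlim).pow 2)).const_mul c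
  have hfreq' : ∃ᶠ n in atTop, c * (J n ω * (1 - J n ω) ^ 2) ≤ J (n + 1) ω - J n ω := by
    refine hfreq.mono fun n hn => ?_
    have h : J (n + 1) ω = ((V n ω).subchannel (linearKernel G) (B n ω)).symCapacity := rfl
    rw [h, hn]
    exact hgain (V n ω)
  -- The gain inequality holds only at times with `B n = i`; holding infinitely often suffices to
  -- pass it to the limit.
  have hle : c * (a * (1 - a) ^ 2) ≤ a - a := le_of_tendsto_of_tendsto_of_frequently hlow hstep hfreq'
  have ha : 0 ≤ a := ge_of_tendsto' hlim fun n => (hmem n ω).1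
  have hz : a * (1 - a) ^ 2 = 0 :=
    le_antisymm (le_of_mul_le_mul_left (by linarith) hc) (by positivity)
  rcases mul_eq_zero.1 hz with h | h
  · exact Or.inl h
  · exact Or.inr (sub_eq_zero.1 (pow_eq_zero_iff two_ne_zero |>.1 h)).symm
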